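/- Let $(\Omega_1,\mathcal A_1)$, $(\Omega_2,\mathcal A_2)$ be measurable spaces, $\mathcal P$, $\mathcal Q$ families of probability measures on them, and $\mathcal P\otimes\mathcal Q=\{P\otimes Q: P\in\mathcal P,\ Q\in\mathcal Q\}$. A curve $t\mapsto P_t$, $|t|<\varepsilon$, in a family $\mathcal R$ of probability measures is *$L_2(0)$-differentiable with tangent* $g\in L_2(P_0)$ if, as $t\to0$, $\big\|2\big((dP_t/dP_0)^{1/2}-1\big)-tg\big\|_{L_2(P_0)}=o(|t|)$ and $P_t(dP_t/dP_0=\infty)=o(t^2)$, where $dP_t/dP_0$ is the $[0,\infty]$-valued density quotient. A functional $k:\mathcal R\to\mathbb R$ is *differentiable at* $R\in\mathcal R$ *with gradient* $\dot k\in L_2(R)$, $\int\dot k\,dR=0$, if $\lim_{t\downarrow0}t^{-1}(k(P_t)-k(P_0))=\int\dot k g\,dR$ for every $L_2(0)$-differentiable curve in $\mathcal R$ with $P_0=R$ and tangent $g$. The *tangent space* at $R$ is the $L_2(R)$-closure of the linear span of all such tangents, and the *canonical gradient* is the gradient that lies in the tangent space and has the smallest $L_2(R)$-norm among all gradients. Let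 $t\mapsto P_t\otimes Q_t$ be an $L_2(0)$-differentiable curve in $\mathcal P\otimes\mathcal Q$ with tangent $g$, and let $k:\mathcal P\otimes\mathcal Q\to\mathbb R$ be differentiable at $P_0\otimes Q_0$ with canonical gradient $\widetilde k$. Put $\widetilde k_1(\omega_1)=\int\widetilde k(\omega_1,\omega_2)\,dQ_0(\omega_2)$ and $\widetilde k_2(\omega_2)=\int\widetilde k(\omega_1,\omega_2)\,dP_0(\omega_1)$. Let $n_1=n_1(n)$, $n_2=n_2(n)$ be sequences of natural numbers with $n_1+n_2=n$ for all $n$ and $\lim_{n\to\infty}n_2/n=d\in(0,1)$. Let $\alpha\in(0,1)$, let $\Phi$ be the standard normal distribution function, $u_{1-\alpha}=\Phi^{-1}(1-\alpha)$, and $$\sigma^2=\frac1{1-d}\int\widetilde k_1^2\,dP_0+\frac1d\int\widetilde k_2^2\,dQ_0,\qquad T_n=\frac{\sqrt n}{n_1n_2}\sum_{i=1}^{n_1}\sum_{j=1}^{n_2}\widetilde k(\omega_{1,i},\omega_{2,j}),\qquad \psi_n=\mathbf 1_{\{T_n>u_{1-\alpha}\sigma\}}.$$ Suppose $\int\widetilde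 k^2\,dP_0\otimes Q_0\neq0$ and $\int\widetilde k g\,dP_0\otimes Q_0\neq0$. Let $\vartheta\in\mathbb R\setminus\{0\}$ and let $(t_n)$ be a sequence with $t_n\to0$ and $$k(P_{t_n}\otimes Q_{t_n})=k(P_0\otimes Q_0)+n^{-1/2}\vartheta+o(n^{-1/2})\qquad(n\to\infty).$$ Then the sequence $(\psi_n)$ is asymptotically $\{0\}$-$\alpha$-similar, that is, $\lim_{n\to\infty}\int\psi_n\,dP_0^{n_1}\otimes Q_0^{n_2}=\alpha$, and $$\lim_{n\to\infty}\int\psi_n\,dP_{t_n}^{n_1}\otimes Q_{t_n}^{n_2}=\Phi\Big(\vartheta\Big(\frac1{1-d}\int\widetilde k_1^2\,dP_0+\frac1d\int\widetilde k_2^2\,dQ_0\Big)^{-1/2}-u_{1-\alpha}\Big).$$ In particular, for $\vartheta<0$ the sequence $(\psi_n)$ asymptotically keeps the level $\alpha$: $\limsup_{n\to\infty}\int\psi_n\,dP_{t_n}^{n_1}\otimes Q_{t_n}^{n_2}\le\alpha$. -/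

import Mathlib

open MeasureTheory ProbabilityTheory Filter Topology Asymptotics
open scoped ENNReal

namespace TwoSample

noncomputable section

/-- The density quotient `dP/dQ` of two probability measures (with values in `[0, ∞]`):
with `μ = P + Q`, `f_P = dP/dμ` and `f_Q = dQ/dμ` it is `f_P / f_Q` where `f_Q > 0`
and `∞` where `f_Q = 0 < f_P`  (in `ℝ≥0∞` one has `a / 0 = ∞` for `a ≠ 0` and `0 / 0 = 0`). -/
def densityQuotient {Ω : Type*} [MeasurableSpace Ω] (P Q : Measure Ω) (ω : Ω) : ℝ≥0∞ :=
  P.rnDeriv (P + Q) ω / Q.rnDeriv (P + Q) ω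

/-- `t ↦ p t` is an `L₂(p 0)`-differentiable curve in the family `ℱ` with tangent `g ∈ L₂(p 0)`.
A curve `(-ε, ε) → ℱ` is represented by a function on `ℝ` whose values for `|t| ≥ ε` are
irrelevant. -/
structure IsL2Curve {Ω : Type*} [MeasurableSpace Ω] (ℱ : Set (ProbabilityMeasure Ω))
    (p : ℝ → ProbabilityMeasure Ω) (g : Ω → ℝ) : Prop where
  mem_family : ∃ ε : ℝ, 0 < ε ∧ ∀ t : ℝ, |t| < ε → p t ∈ ℱ
  memLp : MemLp g 2 (p 0 : Measure Ω)
  expansion :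
    (fun t : ℝ => (eLpNorm
        (fun ω => 2 * (√((densityQuotient (p t : Measure Ω) (p 0 : Measure Ω) ω).toReal) - 1)
          - t * g ω) 2 (p 0 : Measure Ω)).toReal)
      =o[𝓝 0] (fun t : ℝ => |t|)
  singular :
    (fun t : ℝ => (p t : Measure Ω).real
        {ω | densityQuotient (p t : Measure Ω) (p 0 : Measure Ω) ω = ∞})
      =o[𝓝 0] (fun t : ℝ => t ^ 2)

/-- The tangent cone `K(P, ℱ)`, a subset of `L₂⁽⁰⁾(P) ⊆ L₂(P)`. -/
def tangentCone {Ω : Type*} [MeasurableSpace Ω] (P : ProbabilityMeasure Ω)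
    (ℱ : Set (ProbabilityMeasure Ω)) : Set (Lp ℝ 2 (P : Measure Ω)) :=
  {g | ∫ ω, g ω ∂(P : Measure Ω) = 0 ∧
    ∃ p : ℝ → ProbabilityMeasure Ω, p 0 = P ∧ IsL2Curve ℱ p g}

/-- The tangent space `T(P, ℱ)`: the closure in `L₂(P)` of the linear span of `K(P, ℱ)`. -/
def tangentSpace {Ω : Type*} [MeasurableSpace Ω] (P : ProbabilityMeasure Ω)
    (ℱ : Set (ProbabilityMeasure Ω)) : Submodule ℝ (Lp ℝ 2 (P : Measure Ω)) :=
  (Submodule.span ℝ (tangentCone P ℱ)).topologicalClosure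

/-- `κ ∈ L₂⁽⁰⁾(P)` is a gradient at `P` of the statistical functional `k : ℱ → ℝ`
(i.e. `k` is differentiable at `P` with gradient `κ`).  The functional is represented by a
function on all probability measures; only its values on `ℱ` matter, since `p t ∈ ℱ` for all
small `t`. -/
structure IsGradient {Ω : Type*} [MeasurableSpace Ω] (ℱ : Set (ProbabilityMeasure Ω))
    (k : ProbabilityMeasure Ω → ℝ) (P : ProbabilityMeasure Ω) (κ : Ω → ℝ) : Prop where
  memLp : MemLp κ 2 (P : Measure Ω)
  integral_eq_zero : ∫ ω, κ ω ∂(P : Measure Ω) = 0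
  tendsto : ∀ (p : ℝ → ProbabilityMeasure Ω) (g : Ω → ℝ), p 0 = P → IsL2Curve ℱ p g →
    Tendsto (fun t : ℝ => 1 / t * (k (p t) - k (p 0))) (𝓝[>] 0)
      (𝓝 (∫ ω, κ ω * g ω ∂(P : Measure Ω)))

/-- `κ` is (a version of) the canonical gradient of `k` at `P`: the gradient that lies in the
tangent space `T(P, ℱ)` and has the smallest `L₂(P)`-norm among all gradients. -/
structure IsCanonicalGradient {Ω : Type*} [MeasurableSpace Ω] (ℱ : Set (ProbabilityMeasure Ω))
    (k : ProbabilityMeasure Ω → ℝ) (P : ProbabilityMeasure Ω) (κ : Ω → ℝ) : Prop where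
  isGradient : IsGradient ℱ k P κ
  mem_tangentSpace : isGradient.memLp.toLp κ ∈ tangentSpace P ℱ
  norm_le : ∀ κ' : Ω → ℝ, IsGradient ℱ k P κ' →
    eLpNorm κ 2 (P : Measure Ω) ≤ eLpNorm κ' 2 (P : Measure Ω)

/-- The family `ℱ₁ ⊗ ℱ₂ = {P ⊗ Q : P ∈ ℱ₁, Q ∈ ℱ₂}` of product measures. -/
def productFamily {Ω₁ Ω₂ : Type*} [MeasurableSpace Ω₁] [MeasurableSpace Ω₂]
    (ℱ₁ : Set (ProbabilityMeasure Ω₁)) (ℱ₂ : Set (ProbabilityMeasure Ω₂)) :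
    Set (ProbabilityMeasure (Ω₁ × Ω₂)) :=
  {μ | ∃ P ∈ ℱ₁, ∃ Q ∈ ℱ₂, μ = P.prod Q}

/-- First component `ω₁ ↦ ∫ κ(ω₁, ω₂) dQ₀(ω₂)`. -/
def component₁ {Ω₁ Ω₂ : Type*} [MeasurableSpace Ω₂] (κ : Ω₁ × Ω₂ → ℝ)
    (Q₀ : ProbabilityMeasure Ω₂) (x : Ω₁) : ℝ :=
  ∫ y, κ (x, y) ∂(Q₀ : Measure Ω₂)

/-- Second component `ω₂ ↦ ∫ κ(ω₁, ω₂) dP₀(ω₁)`. -/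
def component₂ {Ω₁ Ω₂ : Type*} [MeasurableSpace Ω₁] (κ : Ω₁ × Ω₂ → ℝ)
    (P₀ : ProbabilityMeasure Ω₁) (y : Ω₂) : ℝ :=
  ∫ x, κ (x, y) ∂(P₀ : Measure Ω₁)

/-- The law `P^{n₁} ⊗ Q^{n₂}` of two independent i.i.d. samples of sizes `n₁` and `n₂`. -/
def sampleLaw {Ω₁ Ω₂ : Type*} [MeasurableSpace Ω₁] [MeasurableSpace Ω₂]
    (P : ProbabilityMeasure Ω₁) (Q : ProbabilityMeasure Ω₂) (n₁ n₂ : ℕ) :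
    Measure ((Fin n₁ → Ω₁) × (Fin n₂ → Ω₂)) :=
  (Measure.pi fun _ : Fin n₁ => (P : Measure Ω₁)).prod
    (Measure.pi fun _ : Fin n₂ => (Q : Measure Ω₂))

/-- The two-sample U-statistic `U_{n₁,n₂}` with kernel `κ`. -/
def uStatistic {Ω₁ Ω₂ : Type*} (κ : Ω₁ × Ω₂ → ℝ) (n₁ n₂ : ℕ)
    (ω : (Fin n₁ → Ω₁) × (Fin n₂ → Ω₂)) : ℝ :=
  1 / ((n₁ : ℝ) * (n₂ : ℝ)) * ∑ i : Fin n₁, ∑ j : Fin n₂, κ (ω.1 i, ω.2 j)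

/-- The test statistic `T_n = √n U_{n₁,n₂}`, where `n = n₁ + n₂`. -/
def testStatistic {Ω₁ Ω₂ : Type*} (κ : Ω₁ × Ω₂ → ℝ) (n₁ n₂ : ℕ)
    (ω : (Fin n₁ → Ω₁) × (Fin n₂ → Ω₂)) : ℝ :=
  √((n₁ : ℝ) + (n₂ : ℝ)) * uStatistic κ n₁ n₂ ω

/-- The asymptotic variance `(1-d)⁻¹ ∫ κ₁² dP₀ + d⁻¹ ∫ κ₂² dQ₀`. -/
def asymptoticVariance {Ω₁ Ω₂ : Type*} [MeasurableSpace Ω₁] [MeasurableSpace Ω₂]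
    (κ : Ω₁ × Ω₂ → ℝ) (P₀ : ProbabilityMeasure Ω₁) (Q₀ : ProbabilityMeasure Ω₂) (d : ℝ) : ℝ :=
  1 / (1 - d) * ∫ x, component₁ κ Q₀ x ^ 2 ∂(P₀ : Measure Ω₁)
    + 1 / d * ∫ y, component₂ κ P₀ y ^ 2 ∂(Q₀ : Measure Ω₂)

/-- The distribution function `Φ` of the standard normal distribution. -/
def stdNormalCDF (x : ℝ) : ℝ := cdf (gaussianReal 0 1) x

/-- The quantile `u_q = Φ⁻¹(q)` of the standard normal distribution, for `0 < q < 1`. -/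
def stdNormalQuantile (q : ℝ) : ℝ := sInf {x : ℝ | q ≤ stdNormalCDF x}

/-- The one-sided test `ψ_n`: it is `1` if `T_n > c` and `0` if `T_n ≤ c`, with the critical value
`c = u_{1-α} ((1-d)⁻¹ ∫ κ₁² dP₀ + d⁻¹ ∫ κ₂² dQ₀)^{1/2}`. -/
def oneSidedTest {Ω₁ Ω₂ : Type*} [MeasurableSpace Ω₁] [MeasurableSpace Ω₂]
    (κ : Ω₁ × Ω₂ → ℝ) (P₀ : ProbabilityMeasure Ω₁) (Q₀ : ProbabilityMeasure Ω₂) (d α : ℝ)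
    (n₁ n₂ : ℕ) (ω : (Fin n₁ → Ω₁) × (Fin n₂ → Ω₂)) : ℝ :=
  if stdNormalQuantile (1 - α) * √(asymptoticVariance κ P₀ Q₀ d) < testStatistic κ n₁ n₂ ω
  then 1 else 0

/-- A sequence of tests `φ n` is asymptotically `{0}`-`α`-similar (for the distributions `ν n`
at the parameter value `0`) if `E_{ν n}(φ n) → α`. -/
def AsymptoticallySimilar {X : ℕ → Type*} [∀ n, MeasurableSpace (X n)]
    (ν : ∀ n, Measure (X n)) (φ : ∀ n, X n → ℝ) (α : ℝ) : Prop :=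
  Tendsto (fun n => ∫ ω, φ n ω ∂(ν n)) atTop (𝓝 α)

end

end TwoSample

/-!
The kernel `κ` is a canonical gradient on a product family, and this makes the test statistic a
sum of independent terms. Indeed `P_t ⊗ Q_t (A × B) = P_t(A) Q_t(B)`; differentiating at `t = 0`
gives a product rule for the integrals of a tangent over rectangles
(`IsL2Curve.setIntegral_prod_eq`). The rule is a family of orthogonality relations in `L₂`, hence
passes to the tangent space, and a function that satisfies it is `κ₁(x) + κ₂(y)` almost everywhere
(`IsCanonicalGradient.ae_eq_add_component`). So `T_n` equals
`(√n / n₁) ∑ κ₁(x_i) + (√n / n₂) ∑ κ₂(y_j)` almost surely under `P₀ ⊗ Q₀`. Under the alternatives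
this may fail, but only when one of the `n` observations falls into the singular part of `P_t` or
`Q_t`, which has probability at most `n · o(t²) → 0` (`sampleLaw_exists_not_le`).

The limit law of the additive statistic is found from characteristic functions, without
contiguity or Le Cam's third lemma. Put `h = exp(i c f) - 1` with `c` of order `1 / √n`, and write
`u = (dP_t/dP_0)^{1/2}`. Then `∫ h dP_t - ∫ h dP_0` equals `2 ∫ h (u - 1) dP_0 + ∫ h (u - 1)² dP_0`
up to the singular part. Since `√n (u - 1)` converges to `τ g / 2` in `L₂` when `√n t_n → τ`, and
`√n h` converges to `i s f` in `L₂`, where `s = lim √n c`, the tangent contributes the drift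
`i s τ ∫ f g` to the limit of `n (∫ exp(i c f) dP_{t_n} - 1)`, next to the usual `- s² ∫ f² / 2`
(`IsL2Curve.tendsto_integral_sub`, `IsL2Curve.tendsto_mul_charFun_sub_one`). By Lévy's theorem
`T_n` is asymptotically normal with mean `τ ∫ κ g` and variance `σ²`.

Finally, `k` has the two-sided derivative `∫ κ g` along the curve, so the assumed expansion of
`k (P_{t_n} ⊗ Q_{t_n})` forces `τ = ϑ / ∫ κ g` (`IsGradient.tendsto_sqrt_mul`). The mean is
therefore `ϑ` under the alternatives, and `0` at the fixed parameter `t = 0`.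
-/

namespace TwoSample

/-! ### Density quotients and Lebesgue decomposition -/

section DensityQuotient

variable {Ω : Type*} [MeasurableSpace Ω] (P Q : Measure Ω)

theorem measurable_densityQuotient : Measurable (densityQuotient P Q) :=
  (Measure.measurable_rnDeriv _ _).div (Measure.measurable_rnDeriv _ _)

theorem measurableSet_densityQuotient_eq_top :
    MeasurableSet {ω | densityQuotient P Q ω = ∞} :=
  measurable_densityQuotient P Q (measurableSet_singleton ∞)

/-- Lebesgue decomposition of `P` with respect to `Q` read off from the density quotient. -/
theorem eq_withDensity_densityQuotient_add_restrict [IsFiniteMeasure P] [IsFiniteMeasure Q] :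
    P = Q.withDensity (densityQuotient P Q) + P.restrict {ω | densityQuotient P Q ω = ∞} := by
  have hP : (P + Q).withDensity (P.rnDeriv (P + Q)) = P :=
    Measure.withDensity_rnDeriv_eq _ _ (Measure.AbsolutelyContinuous.rfl.add_right Q)
  have hQ : (P + Q).withDensity (Q.rnDeriv (P + Q)) = Q :=
    Measure.withDensity_rnDeriv_eq _ _ (by
      rw [add_comm]; exact Measure.AbsolutelyContinuous.rfl.add_right P)
  have hm := measurable_densityQuotient P Q
  have hS := measurableSet_densityQuotient_eq_top P Q
  set S := {ω | densityQuotient P Q ω = ∞} with hSdef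
  have h1 : Q.withDensity (densityQuotient P Q)
      = (P + Q).withDensity (Q.rnDeriv (P + Q) * densityQuotient P Q) := by
    rw [withDensity_mul _ (Measure.measurable_rnDeriv _ _) hm, hQ]
  have h2 : P.restrict S = (P + Q).withDensity (S.indicator (P.rnDeriv (P + Q))) := by
    rw [withDensity_indicator hS, ← restrict_withDensity hS, hP]
  rw [h1, h2, ← withDensity_add_left ((Measure.measurable_rnDeriv _ _).mul hm)]
  conv_lhs => rw [← hP]
  refine withDensity_congr_ae ?_
  filter_upwards [Measure.rnDeriv_lt_top P (P + Q), Measure.rnDeriv_lt_top Q (P + Q)] with ω h h'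
  simp only [Pi.add_apply, Pi.mul_apply]
  by_cases h0 : Q.rnDeriv (P + Q) ω = 0
  · by_cases hf : P.rnDeriv (P + Q) ω = 0
    · by_cases hω : ω ∈ S <;> simp [h0, hf, hω]
    · have : ω ∈ S := by
        simp only [hSdef, Set.mem_ofPred_eq, densityQuotient, h0]
        exact ENNReal.div_zero hf
      simp [this, h0]
  · have : ω ∉ S := by
      simp only [hSdef, Set.mem_ofPred_eq, densityQuotient]
      exact ENNReal.div_ne_top h.ne h0
    simp only [this, not_false_eq_true, Set.indicator_of_notMem, add_zero, densityQuotient]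
    exact (ENNReal.mul_div_cancel h0 h'.ne).symm

/-- A `Q`-null set carries only mass of the part of `P` that is singular to `Q`. -/
theorem measure_le_of_measure_eq_zero [IsFiniteMeasure P] [IsFiniteMeasure Q] {N : Set Ω}
    (hN : Q N = 0) : P N ≤ P {ω | densityQuotient P Q ω = ∞} := by
  conv_lhs => rw [eq_withDensity_densityQuotient_add_restrict P Q]
  rw [Measure.add_apply, (withDensity_absolutelyContinuous Q _) hN, zero_add]
  exact (measure_mono (Set.subset_univ _)).trans (by rw [Measure.restrict_apply_univ])

theorem lintegral_densityQuotient_le [IsFiniteMeasure P] [IsFiniteMeasure Q] :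
    ∫⁻ ω, densityQuotient P Q ω ∂Q ≤ P Set.univ := by
  conv_rhs => rw [eq_withDensity_densityQuotient_add_restrict P Q]
  rw [Measure.add_apply, withDensity_apply _ MeasurableSet.univ, Measure.restrict_univ]
  exact le_self_add

theorem ae_densityQuotient_lt_top [IsFiniteMeasure P] [IsFiniteMeasure Q] :
    ∀ᵐ ω ∂Q, densityQuotient P Q ω < ∞ :=
  ae_lt_top (measurable_densityQuotient P Q)
    ((lintegral_densityQuotient_le P Q).trans_lt (measure_lt_top P _)).ne

/-- The deviation `(dP/dQ)^{1/2} - 1` of the root of the density quotient from `1`. -/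
noncomputable def rootDeviation (ω : Ω) : ℝ := √((densityQuotient P Q ω).toReal) - 1

theorem memLp_rootDeviation [IsFiniteMeasure P] [IsFiniteMeasure Q] :
    MemLp (rootDeviation P Q) 2 Q := by
  have hm : Measurable fun ω => √((densityQuotient P Q ω).toReal) :=
    (measurable_densityQuotient P Q).ennreal_toReal.sqrt
  refine MemLp.sub (f := fun ω => √((densityQuotient P Q ω).toReal)) ?_ (memLp_const 1)
  rw [memLp_two_iff_integrable_sq hm.aestronglyMeasurable]
  simp only [Real.sq_sqrt ENNReal.toReal_nonneg]
  exact integrable_toReal_of_lintegral_ne_top (measurable_densityQuotient P Q).aemeasurable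
    ((lintegral_densityQuotient_le P Q).trans_lt (measure_lt_top P _)).ne

/-- Expansion of `∫ h dP - ∫ h dQ` in powers of `(dP/dQ)^{1/2} - 1`; the error comes from the
singular part of `P` only. -/
theorem norm_integral_sub_expansion_le [IsFiniteMeasure P] [IsFiniteMeasure Q] {h : Ω → ℂ}
    (hm : Measurable h) {C : ℝ} (hC : ∀ ω, ‖h ω‖ ≤ C) :
    ‖∫ ω, h ω ∂P - ∫ ω, h ω ∂Q
        - (2 * ∫ ω, h ω * (rootDeviation P Q ω : ℂ) ∂Q
          + ∫ ω, h ω * (rootDeviation P Q ω : ℂ) ^ 2 ∂Q)‖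
      ≤ C * P.real {ω | densityQuotient P Q ω = ∞} := by
  set S := {ω | densityQuotient P Q ω = ∞} with hS
  have hint : ∀ (μ : Measure Ω) [IsFiniteMeasure μ], Integrable h μ := fun μ _ =>
    Integrable.of_bound hm.aestronglyMeasurable C (ae_of_all _ hC)
  have hfin : IsFiniteMeasure (Q.withDensity (densityQuotient P Q)) :=
    isFiniteMeasure_withDensity
      ((lintegral_densityQuotient_le P Q).trans_lt (measure_lt_top P _)).ne
  have hsplit : ∫ ω, h ω ∂P
      = ∫ ω, h ω * ((densityQuotient P Q ω).toReal : ℂ) ∂Q + ∫ ω in S, h ω ∂P := by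
    conv_lhs => rw [eq_withDensity_densityQuotient_add_restrict P Q]
    rw [integral_add_measure (hint _) (hint _),
      integral_withDensity_eq_integral_toReal_smul (measurable_densityQuotient P Q)
        (ae_densityQuotient_lt_top P Q)]
    simp only [Complex.real_smul, mul_comm (h _), hS]
  have hw := memLp_rootDeviation P Q
  have i1 : Integrable
      (fun ω => h ω * (rootDeviation P Q ω : ℂ)) Q :=
    (hw.integrable one_le_two).ofReal.bdd_mul hm.aestronglyMeasurable (ae_of_all _ hC)
  have i2 : Integrable
      (fun ω => h ω * (rootDeviation P Q ω : ℂ) ^ 2) Q := by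
    have : Integrable
      (fun ω => h ω * ((rootDeviation P Q ω ^ 2 : ℝ) : ℂ)) Q :=
      hw.integrable_sq.ofReal.bdd_mul hm.aestronglyMeasurable (ae_of_all _ hC)
    simpa using this
  have hmain : ∫ ω, h ω * ((densityQuotient P Q ω).toReal : ℂ) ∂Q
      = ∫ ω, h ω ∂Q + (2 * ∫ ω, h ω * (rootDeviation P Q ω : ℂ) ∂Q
          + ∫ ω, h ω * (rootDeviation P Q ω : ℂ) ^ 2 ∂Q) := by
    rw [← integral_const_mul, ← integral_add' (i1.const_mul 2) i2,
      ← integral_add' (hint Q) ((i1.const_mul 2).add i2)]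
    refine integral_congr_ae (ae_of_all _ fun ω => ?_)
    have : ((densityQuotient P Q ω).toReal : ℂ)
        = ((√((densityQuotient P Q ω).toReal) : ℝ) : ℂ) ^ 2 := by
      rw [← Complex.ofReal_pow, Real.sq_sqrt ENNReal.toReal_nonneg]
    simp only [this, Pi.add_apply, rootDeviation]
    push_cast
    ring
  have hrest : ‖∫ ω in S, h ω ∂P‖ ≤ C * P.real S :=
    norm_setIntegral_le_of_norm_le_const (measure_lt_top P S) fun ω _ => hC ω
  rw [hsplit, hmain]
  convert hrest using 2
  ring

end DensityQuotient

/-! ### Convergence in `L₂` -/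

section L2

variable {Ω : Type*} [MeasurableSpace Ω] {μ : Measure Ω} {ι : Type*} {l : Filter ι}

/-- Continuity of the `L₂` pairing. -/
theorem tendsto_integral_mul_of_tendsto_eLpNorm {F : ι → Ω → ℂ} {F₀ : Ω → ℂ} {w : ι → Ω → ℝ}
    {w₀ : Ω → ℝ} (hF : ∀ i, MemLp (F i) 2 μ) (hF₀ : MemLp F₀ 2 μ) (hw : ∀ i, MemLp (w i) 2 μ)
    (hw₀ : MemLp w₀ 2 μ) (hFF₀ : Tendsto (fun i => eLpNorm (F i - F₀) 2 μ) l (𝓝 0))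
    (hww₀ : Tendsto (fun i => eLpNorm (w i - w₀) 2 μ) l (𝓝 0)) :
    Tendsto (fun i => ∫ ω, F i ω * (w i ω : ℂ) ∂μ) l (𝓝 (∫ ω, F₀ ω * (w₀ ω : ℂ) ∂μ)) := by
  have key : ∀ {f : Ω → ℂ} {v : Ω → ℝ} (hf : MemLp f 2 μ) (hv : MemLp v 2 μ),
      ∫ ω, f ω * (v ω : ℂ) ∂μ = inner ℂ (hv.ofReal (K := ℂ)).toLp (hf.toLp f) := by
    intro f v hf hv
    rw [L2.inner_def]
    refine integral_congr_ae ?_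
    filter_upwards [hf.coeFn_toLp, (hv.ofReal (K := ℂ)).coeFn_toLp] with ω h1 h2
    rw [h1, h2]
    simp [RCLike.inner_apply]
  simp_rw [key (hF _) (hw _), key hF₀ hw₀]
  refine Tendsto.inner ?_ ?_
  · rw [Lp.tendsto_Lp_iff_tendsto_eLpNorm'']
    refine hww₀.congr fun i => ?_
    refine eLpNorm_congr_norm_ae (ae_of_all _ fun ω => ?_)
    simp only [Pi.sub_apply, ← RCLike.ofReal_sub, RCLike.norm_ofReal, Real.norm_eq_abs]
  · rw [Lp.tendsto_Lp_iff_tendsto_eLpNorm'']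
    exact hFF₀

/-- Dominated convergence in `L₂`. -/
theorem tendsto_eLpNorm_sub_of_dominated {F : ℕ → Ω → ℂ} {F₀ : Ω → ℂ} {G : Ω → ℝ}
    (hF : ∀ n, AEStronglyMeasurable (F n) μ) (hF₀ : AEStronglyMeasurable F₀ μ)
    (hG : MemLp G 2 μ)
    (hb : ∀ n, ∀ᵐ ω ∂μ, ‖F n ω - F₀ ω‖ ≤ G ω)
    (hlim : ∀ᵐ ω ∂μ, Tendsto (fun n => F n ω) atTop (𝓝 (F₀ ω))) :
    Tendsto (fun n => eLpNorm (F n - F₀) 2 μ) atTop (𝓝 0) := by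
  have h2 : Tendsto (fun n => ∫⁻ ω, ‖F n ω - F₀ ω‖ₑ ^ (2 : ℝ) ∂μ) atTop
      (𝓝 (∫⁻ _, 0 ∂μ)) := by
    refine tendsto_lintegral_of_dominated_convergence' (fun ω => ‖G ω‖ₑ ^ (2 : ℝ))
      (fun n => ((hF n).sub hF₀).enorm.pow_const _) (fun n => ?_) ?_ ?_
    · filter_upwards [hb n] with ω hω
      gcongr
      exact enorm_le_iff_norm_le.2 (hω.trans (le_abs_self _))
    · exact (lintegral_rpow_enorm_lt_top_of_eLpNorm_lt_top two_ne_zero ENNReal.ofNat_ne_top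
        hG.2).ne
    · filter_upwards [hlim] with ω hω
      have h0 : Tendsto (fun n => ‖F n ω - F₀ ω‖ₑ) atTop (𝓝 0) := by
        have := (tendsto_sub_nhds_zero_iff.2 hω).enorm
        simpa using this
      have := (ENNReal.continuous_rpow_const (y := 2)).tendsto 0 |>.comp h0
      simpa [Function.comp_def] using this
  simp only [lintegral_zero] at h2
  have h3 := (ENNReal.continuous_rpow_const (y := 1 / 2)).tendsto 0 |>.comp h2
  simp only [one_div, ENNReal.zero_rpow_of_pos (by norm_num : (0 : ℝ) < 2⁻¹)] at h3
  refine h3.congr fun n => ?_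
  rw [eLpNorm_eq_lintegral_rpow_enorm_toReal two_ne_zero ENNReal.ofNat_ne_top]
  simp

end L2

/-! ### Expansions along `L₂`-differentiable curves -/

section Curve

variable {Ω : Type*} [MeasurableSpace Ω] {ℱ : Set (ProbabilityMeasure Ω)}
  {p : ℝ → ProbabilityMeasure Ω} {g : Ω → ℝ}

/-- The defining expansion of an `L₂`-differentiable curve, rescaled by `b n` with
`b n * t n → τ`. -/
theorem IsL2Curve.tendsto_eLpNorm_rootDeviation (hc : IsL2Curve ℱ p g) {t b : ℕ → ℝ} {τ : ℝ}
    (ht : Tendsto t atTop (𝓝 0)) (hbt : Tendsto (fun n => b n * t n) atTop (𝓝 τ)) :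
    Tendsto (fun n => eLpNorm
      ((fun ω => b n * rootDeviation (p (t n) : Measure Ω) (p 0 : Measure Ω) ω)
        - fun ω => τ / 2 * g ω) 2 (p 0 : Measure Ω)) atTop (𝓝 0) := by
  set r : ℝ → Ω → ℝ := fun s ω =>
    2 * rootDeviation (p s : Measure Ω) (p 0 : Measure Ω) ω - s * g ω with hr
  have hrm : ∀ s, MemLp (r s) 2 (p 0 : Measure Ω) := fun s =>
    ((memLp_rootDeviation _ _).const_mul 2).sub (hc.memLp.const_mul s)
  have hro : (fun n => b n * (eLpNorm (r (t n)) 2 (p 0 : Measure Ω)).toReal)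
      =o[atTop] fun _ => (1 : ℝ) := by
    refine ((isBigO_refl b atTop).mul_isLittleO (hc.expansion.comp_tendsto ht)).trans_isBigO ?_
    refine IsBigO.trans ?_ (hbt.isBigO_one ℝ)
    exact IsBigO.of_bound 1 (by simp)
  have h1 : Tendsto (fun n => ENNReal.ofReal
      (‖b n * (eLpNorm (r (t n)) 2 (p 0 : Measure Ω)).toReal‖ / 2)) atTop (𝓝 0) := by
    have := ((isLittleO_one_iff ℝ).1 hro).norm.div_const 2
    simpa using ENNReal.tendsto_ofReal this
  have h2 : Tendsto (fun n => ‖(b n * t n - τ) / 2‖ₑ * eLpNorm g 2 (p 0 : Measure Ω)) atTop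
      (𝓝 0) := by
    have := ((tendsto_sub_nhds_zero_iff.2 hbt).div_const 2).enorm
    simpa using ENNReal.Tendsto.mul_const this (Or.inr hc.memLp.2.ne)
  have h12 := h1.add h2
  rw [add_zero] at h12
  refine tendsto_of_tendsto_of_tendsto_of_le_of_le tendsto_const_nhds h12
    (fun _ => zero_le) fun n => ?_
  have heq : ((fun ω => b n * rootDeviation (p (t n) : Measure Ω) (p 0 : Measure Ω) ω)
        - fun ω => τ / 2 * g ω) = (b n / 2) • r (t n) + ((b n * t n - τ) / 2) • g := by
    ext ω
    simp only [hr, Pi.sub_apply, Pi.add_apply, Pi.smul_apply, smul_eq_mul]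
    ring
  rw [heq]
  refine (eLpNorm_add_le ((hrm _).const_smul _).1 (hc.memLp.const_smul _).1 one_le_two).trans ?_
  rw [eLpNorm_const_smul, eLpNorm_const_smul]
  gcongr
  rw [norm_mul, mul_div_right_comm, ENNReal.ofReal_mul (by positivity), Real.norm_of_nonneg
    (ENNReal.toReal_nonneg), ENNReal.ofReal_toReal (hrm _).2.ne, ← ofReal_norm]
  simp

/-- The singular mass along the curve is negligible against `1 / b n ^ 2`. -/
theorem IsL2Curve.tendsto_mul_singular (hc : IsL2Curve ℱ p g) {t b : ℕ → ℝ} {τ : ℝ}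
    (ht : Tendsto t atTop (𝓝 0)) (hbt : Tendsto (fun n => b n * t n) atTop (𝓝 τ)) :
    Tendsto (fun n => b n ^ 2 * (p (t n) : Measure Ω).real
      {ω | densityQuotient (p (t n) : Measure Ω) (p 0 : Measure Ω) ω = ∞}) atTop (𝓝 0) := by
  refine (isLittleO_one_iff ℝ).1 ?_
  refine ((isBigO_refl (fun n => b n ^ 2) atTop).mul_isLittleO
    (hc.singular.comp_tendsto ht)).trans_isBigO ?_
  simpa [mul_pow] using (hbt.pow 2).isBigO_one ℝ

/-- First-order expansion of the expectations of bounded functions along an `L₂`-differentiable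
curve. With `a = 1` and `b = 1 / t` it differentiates expectations of a fixed function; with
`a = b = √n` it treats functions `h n` of size `1 / √n` at the contiguous rate. -/
theorem IsL2Curve.tendsto_integral_sub (hc : IsL2Curve ℱ p g) {t a b : ℕ → ℝ} {τ : ℝ}
    (ht : Tendsto t atTop (𝓝 0)) (hbt : Tendsto (fun n => b n * t n) atTop (𝓝 τ))
    (hb : ∀ᶠ n in atTop, b n ≠ 0) (hab : ∀ n, |a n / b n| ≤ 1)
    {h : ℕ → Ω → ℂ} {H : Ω → ℂ} (hm : ∀ n, Measurable (h n)) (h2 : ∀ n ω, ‖h n ω‖ ≤ 2)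
    (hH : MemLp H 2 (p 0 : Measure Ω))
    (hhH : Tendsto (fun n => eLpNorm ((fun ω => (a n : ℂ) * h n ω) - H) 2 (p 0 : Measure Ω))
      atTop (𝓝 0))
    (h0 : ∀ ω, Tendsto (fun n => ((a n / b n : ℝ) : ℂ) * h n ω) atTop (𝓝 0)) :
    Tendsto (fun n => ((a n * b n : ℝ) : ℂ) *
      (∫ ω, h n ω ∂(p (t n) : Measure Ω) - ∫ ω, h n ω ∂(p 0 : Measure Ω))) atTop
      (𝓝 (τ * ∫ ω, H ω * (g ω : ℂ) ∂(p 0 : Measure Ω))) := by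
  set w : ℕ → Ω → ℝ := fun n ω =>
    b n * rootDeviation (p (t n) : Measure Ω) (p 0 : Measure Ω) ω with hw
  have hwm : ∀ n, MemLp (w n) 2 (p 0 : Measure Ω) := fun n =>
    (memLp_rootDeviation _ _).const_mul _
  have hw₀ : MemLp (fun ω => τ / 2 * g ω) 2 (p 0 : Measure Ω) := hc.memLp.const_mul _
  have hww := hc.tendsto_eLpNorm_rootDeviation ht hbt
  have hk2 : ∀ n ω, ‖((a n / b n : ℝ) : ℂ) * h n ω‖ ≤ 2 := fun n ω => by
    rw [norm_mul, Complex.norm_real, Real.norm_eq_abs]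
    calc _ ≤ 1 * 2 := mul_le_mul (hab n) (h2 n ω) (norm_nonneg _) zero_le_one
      _ = 2 := one_mul 2
  have hkm : ∀ n, Measurable fun ω => ((a n / b n : ℝ) : ℂ) * h n ω := fun n =>
    (hm n).const_mul _
  have hbdd : ∀ {v : Ω → ℝ}, MemLp v 2 (p 0 : Measure Ω) → ∀ n,
      MemLp (fun ω => ((a n / b n : ℝ) : ℂ) * h n ω * (v ω : ℂ)) 2 (p 0 : Measure Ω) := by
    intro v hv n
    refine MemLp.of_le_mul (c := 2) hv
      ((hkm n).aestronglyMeasurable.mul hv.ofReal.aestronglyMeasurable) (ae_of_all _ fun ω => ?_)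
    rw [norm_mul, Complex.norm_real]
    exact mul_le_mul_of_nonneg_right (hk2 n ω) (norm_nonneg _)
  -- the quadratic term vanishes: it is a pairing of `w n` with a sequence tending to `0` in `L₂`
  have hkw : Tendsto (fun n => eLpNorm
      ((fun ω => ((a n / b n : ℝ) : ℂ) * h n ω * (w n ω : ℂ)) - 0) 2 (p 0 : Measure Ω))
      atTop (𝓝 0) := by
    have e1 : Tendsto (fun n => eLpNorm
        ((fun ω => ((a n / b n : ℝ) : ℂ) * h n ω * ((τ / 2 * g ω : ℝ) : ℂ)) - 0) 2
        (p 0 : Measure Ω)) atTop (𝓝 0) := by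
      refine tendsto_eLpNorm_sub_of_dominated (G := fun ω => 2 * ‖τ / 2 * g ω‖)
        (fun n => (hbdd hw₀ n).1) aestronglyMeasurable_const
        (hw₀.norm.const_mul 2) (fun n => ae_of_all _ fun ω => ?_) (ae_of_all _ fun ω => ?_)
      · simp only [Pi.zero_apply, sub_zero, norm_mul (_ * _), Complex.norm_real]
        exact mul_le_mul_of_nonneg_right (hk2 n ω) (norm_nonneg _)
      · simpa using (h0 ω).mul_const ((τ / 2 * g ω : ℝ) : ℂ)
    have e2 : Tendsto (fun n => 2 * eLpNorm (w n - fun ω => τ / 2 * g ω) 2 (p 0 : Measure Ω))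
        atTop (𝓝 0) := by
      simpa using ENNReal.Tendsto.const_mul hww (Or.inr ENNReal.ofNat_ne_top)
    have e12 := e1.add e2
    rw [add_zero] at e12
    refine tendsto_of_tendsto_of_tendsto_of_le_of_le tendsto_const_nhds e12
      (fun _ => zero_le) fun n => ?_
    have hd := (hwm n).sub hw₀
    have heq : ((fun ω => ((a n / b n : ℝ) : ℂ) * h n ω * (w n ω : ℂ)) - 0)
        = ((fun ω => ((a n / b n : ℝ) : ℂ) * h n ω * ((τ / 2 * g ω : ℝ) : ℂ)) - 0)
          + fun ω => ((a n / b n : ℝ) : ℂ) * h n ω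
            * (((w n - fun ω => τ / 2 * g ω) ω : ℝ) : ℂ) := by
      ext ω
      simp only [Pi.sub_apply, Pi.add_apply, Pi.zero_apply]
      push_cast
      ring
    rw [heq]
    refine (eLpNorm_add_le ((hbdd hw₀ n).sub MemLp.zero).1 (hbdd hd n).1 one_le_two).trans ?_
    gcongr
    refine (eLpNorm_le_mul_eLpNorm_of_ae_le_mul (c := 2) (g := w n - fun ω => τ / 2 * g ω)
      (ae_of_all _ fun ω => ?_) 2).trans (by simp)
    rw [norm_mul, Complex.norm_real]
    exact mul_le_mul_of_nonneg_right (hk2 n ω) (norm_nonneg _)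
  have hquad := tendsto_integral_mul_of_tendsto_eLpNorm (fun n => hbdd (hwm n) n) MemLp.zero
    hwm hw₀ hkw hww
  have hlin := tendsto_integral_mul_of_tendsto_eLpNorm
    (fun n => (MemLp.of_bound (hm n).aestronglyMeasurable 2 (ae_of_all _ (h2 n))).const_mul
      (a n : ℂ)) hH hwm hw₀ hhH hww
  have hsing := hc.tendsto_mul_singular ht hbt
  have hlim := (hlin.const_mul 2).add hquad
  have hval : 2 * ∫ ω, H ω * ((τ / 2 * g ω : ℝ) : ℂ) ∂(p 0 : Measure Ω)
      + ∫ ω, (0 : Ω → ℂ) ω * ((τ / 2 * g ω : ℝ) : ℂ) ∂(p 0 : Measure Ω)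
      = τ * ∫ ω, H ω * (g ω : ℂ) ∂(p 0 : Measure Ω) := by
    rw [← integral_const_mul, ← integral_const_mul]
    simp only [Pi.zero_apply, zero_mul, integral_zero, add_zero]
    refine integral_congr_ae (ae_of_all _ fun ω => ?_)
    push_cast
    ring
  rw [hval] at hlim
  have hsing2 := hsing.const_mul 2
  rw [mul_zero] at hsing2
  refine hlim.congr_dist ?_
  refine squeeze_zero' (Eventually.of_forall fun _ => dist_nonneg) ?_ hsing2
  filter_upwards [hb] with n hbn
  have hexp := norm_integral_sub_expansion_le (p (t n) : Measure Ω) (p 0 : Measure Ω)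
    (hm n) (h2 n)
  rw [dist_comm, dist_eq_norm]
  have e1 : 2 * ∫ ω, (a n : ℂ) * h n ω * (w n ω : ℂ) ∂(p 0 : Measure Ω)
      = ((a n * b n : ℝ) : ℂ) * (2 * ∫ ω, h n ω *
        (rootDeviation (p (t n) : Measure Ω) (p 0 : Measure Ω) ω : ℂ) ∂(p 0 : Measure Ω)) := by
    rw [mul_left_comm]
    congr 1
    rw [← integral_const_mul]
    refine integral_congr_ae (ae_of_all _ fun ω => ?_)
    simp only [hw]
    push_cast
    ring
  have e2 : ∫ ω, ((a n / b n : ℝ) : ℂ) * h n ω * (w n ω : ℂ) * (w n ω : ℂ) ∂(p 0 : Measure Ω)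
      = ((a n * b n : ℝ) : ℂ) * ∫ ω, h n ω *
        (rootDeviation (p (t n) : Measure Ω) (p 0 : Measure Ω) ω : ℂ) ^ 2 ∂(p 0 : Measure Ω) := by
    rw [← integral_const_mul]
    refine integral_congr_ae (ae_of_all _ fun ω => ?_)
    have hbn' : (b n : ℂ) ≠ 0 := Complex.ofReal_ne_zero.2 hbn
    simp only [hw]
    push_cast
    field_simp
  rw [e1, e2, ← mul_add, ← mul_sub, norm_mul, Complex.norm_real, Real.norm_eq_abs]
  have hab' : |a n * b n| ≤ b n ^ 2 := by
    have : a n * b n = a n / b n * b n ^ 2 := by field_simp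
    rw [this, abs_mul, abs_of_nonneg (sq_nonneg (b n))]
    exact mul_le_of_le_one_left (sq_nonneg _) (hab n)
  calc _ ≤ b n ^ 2 * (2 * (p (t n) : Measure Ω).real
      {ω | densityQuotient (p (t n) : Measure Ω) (p 0 : Measure Ω) ω = ∞}) :=
        mul_le_mul hab' hexp (norm_nonneg _) (sq_nonneg _)
    _ = _ := by ring

end Curve

/-! ### Additivity of tangents of product families -/

/-- Probabilities are differentiable along an `L₂`-differentiable curve (at the times
`1 / (n + 1)`), with derivative given by the tangent. -/
theorem IsL2Curve.tendsto_measureReal_sub {Ω : Type*} [MeasurableSpace Ω]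
    {ℱ : Set (ProbabilityMeasure Ω)} {p : ℝ → ProbabilityMeasure Ω} {g : Ω → ℝ}
    (hc : IsL2Curve ℱ p g) {A : Set Ω} (hA : MeasurableSet A) :
    Tendsto (fun n : ℕ => ((n : ℝ) + 1) * ((p (1 / ((n : ℝ) + 1)) : Measure Ω).real A
      - (p 0 : Measure Ω).real A)) atTop (𝓝 (∫ ω in A, g ω ∂(p 0 : Measure Ω))) := by
  have hpos : ∀ n : ℕ, (0 : ℝ) < (n : ℝ) + 1 := fun n => by positivity
  have hm : Measurable (A.indicator fun _ => (1 : ℂ)) := measurable_const.indicator hA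
  have h1 : ∀ ω, ‖A.indicator (fun _ => (1 : ℂ)) ω‖ ≤ 1 := fun ω =>
    (norm_indicator_le_norm_self _ _).trans (by simp)
  have key := hc.tendsto_integral_sub (t := fun n : ℕ => 1 / ((n : ℝ) + 1)) (a := fun _ => 1)
    (b := fun n => (n : ℝ) + 1) (τ := 1) (h := fun _ => A.indicator fun _ => (1 : ℂ))
    (H := A.indicator fun _ => (1 : ℂ)) tendsto_one_div_add_atTop_nhds_zero_nat
    (tendsto_const_nhds.congr fun n => by field_simp [(hpos n).ne'])
    (Eventually.of_forall fun n => (hpos n).ne')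
    (fun n => by
      rw [abs_of_nonneg (by positivity), div_le_one (hpos n)]
      linarith [(Nat.cast_nonneg n : (0 : ℝ) ≤ n)])
    (fun _ => hm) (fun _ ω => (h1 ω).trans one_le_two)
    (MemLp.of_bound hm.aestronglyMeasurable 1 (ae_of_all _ h1))
    (by simp)
    (fun ω => by
      have h0 : Tendsto (fun n : ℕ => ((1 / ((n : ℝ) + 1) : ℝ) : ℂ)) atTop (𝓝 ((0 : ℝ) : ℂ)) :=
        (Complex.continuous_ofReal.tendsto 0).comp tendsto_one_div_add_atTop_nhds_zero_nat
      simpa using h0.mul_const (A.indicator (fun _ => (1 : ℂ)) ω))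
  have hint : ∀ μ : Measure Ω, ∫ ω, A.indicator (fun _ => (1 : ℂ)) ω ∂μ = (μ.real A : ℂ) := by
    intro μ
    rw [integral_indicator_const _ hA]
    simp
  have hlim : ((1 : ℝ) : ℂ) * ∫ ω, A.indicator (fun _ => (1 : ℂ)) ω * (g ω : ℂ) ∂(p 0 : Measure Ω)
      = ((∫ ω in A, g ω ∂(p 0 : Measure Ω) : ℝ) : ℂ) := by
    rw [← integral_complex_ofReal, ← integral_indicator hA]
    simp only [Complex.ofReal_one, one_mul]
    refine integral_congr_ae (ae_of_all _ fun ω => ?_)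
    by_cases hω : ω ∈ A <;> simp [hω]
  rw [hlim] at key
  simp only [hint] at key
  have := (Complex.continuous_re.tendsto _).comp key
  simp only [Complex.ofReal_re] at this
  refine this.congr fun n => ?_
  simp only [Function.comp_apply, one_mul]
  rw [← Complex.ofReal_sub, ← Complex.ofReal_mul, Complex.ofReal_re]

section Product

variable {Ω₁ Ω₂ : Type*} [MeasurableSpace Ω₁] [MeasurableSpace Ω₂]

/-- The product rule for tangents: `P_t ⊗ Q_t (A × B) = P_t(A) Q_t(B)` is differentiated
at `t = 0`. -/
theorem IsL2Curve.setIntegral_prod_eq {ℱ₁ : Set (ProbabilityMeasure Ω₁)}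
    {ℱ₂ : Set (ProbabilityMeasure Ω₂)} {p : ℝ → ProbabilityMeasure (Ω₁ × Ω₂)} {g : Ω₁ × Ω₂ → ℝ}
    (hc : IsL2Curve (productFamily ℱ₁ ℱ₂) p g) {P₀ : ProbabilityMeasure Ω₁}
    {Q₀ : ProbabilityMeasure Ω₂} (h0 : p 0 = P₀.prod Q₀) {A : Set Ω₁} {B : Set Ω₂}
    (hA : MeasurableSet A) (hB : MeasurableSet B) :
    ∫ z in A ×ˢ B, g z ∂(P₀.prod Q₀ : Measure (Ω₁ × Ω₂))
      = (Q₀ : Measure Ω₂).real B * ∫ z in A ×ˢ Set.univ, g z ∂(P₀.prod Q₀ : Measure (Ω₁ × Ω₂))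
        + (P₀ : Measure Ω₁).real A
          * ∫ z in Set.univ ×ˢ B, g z ∂(P₀.prod Q₀ : Measure (Ω₁ × Ω₂)) := by
  have hz := hc.tendsto_measureReal_sub (hA.prod hB)
  have hx := hc.tendsto_measureReal_sub (hA.prod MeasurableSet.univ)
  have hy := hc.tendsto_measureReal_sub (MeasurableSet.univ.prod hB)
  have hs : Tendsto (fun n : ℕ => 1 / ((n : ℝ) + 1)) atTop (𝓝 0) :=
    tendsto_one_div_add_atTop_nhds_zero_nat
  have hprod : ∀ {μ : ProbabilityMeasure (Ω₁ × Ω₂)}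
      (_ : ∃ P : ProbabilityMeasure Ω₁, ∃ Q : ProbabilityMeasure Ω₂, μ = P.prod Q),
      (μ : Measure (Ω₁ × Ω₂)).real (A ×ˢ B) = (μ : Measure (Ω₁ × Ω₂)).real (A ×ˢ Set.univ)
        * (μ : Measure (Ω₁ × Ω₂)).real (Set.univ ×ˢ B) := by
    rintro μ ⟨P, Q, rfl⟩
    simp [ProbabilityMeasure.toMeasure_prod, measureReal_prod_prod]
  have hy' : Tendsto (fun n : ℕ => (p (1 / ((n : ℝ) + 1)) : Measure (Ω₁ × Ω₂)).real
      (Set.univ ×ˢ B)) atTop (𝓝 ((p 0 : Measure (Ω₁ × Ω₂)).real (Set.univ ×ˢ B))) := by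
    have := (hs.mul hy).add_const ((p 0 : Measure (Ω₁ × Ω₂)).real (Set.univ ×ˢ B))
    rw [zero_mul, zero_add] at this
    refine this.congr fun n => ?_
    have : (n : ℝ) + 1 ≠ 0 := by positivity
    field_simp
    ring
  have hsum := (hx.mul hy').add (hy.const_mul ((p 0 : Measure (Ω₁ × Ω₂)).real (A ×ˢ Set.univ)))
  have hlim := tendsto_nhds_unique_of_eventuallyEq hz hsum (by
    obtain ⟨ε, hε, hmem⟩ := hc.mem_family
    filter_upwards [hs.eventually (Metric.ball_mem_nhds 0 hε)] with n hn
    obtain ⟨P, -, Q, -, hPQ⟩ := hmem (1 / ((n : ℝ) + 1))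
      (by rwa [dist_zero_right, Real.norm_eq_abs] at hn)
    rw [hprod ⟨P, Q, hPQ⟩, hprod ⟨P₀, Q₀, h0⟩]
    ring)
  rw [h0] at hlim
  rw [hlim]
  simp only [ProbabilityMeasure.toMeasure_prod, measureReal_prod_prod, probReal_univ,
    one_mul, mul_one]
  ring

/-- The product rule passes from tangents to the tangent space: it says that an element is
orthogonal to certain vectors of `L₂`. -/
theorem setIntegral_prod_eq_of_mem_tangentSpace {ℱ₁ : Set (ProbabilityMeasure Ω₁)}
    {ℱ₂ : Set (ProbabilityMeasure Ω₂)} {P₀ : ProbabilityMeasure Ω₁}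
    {Q₀ : ProbabilityMeasure Ω₂} {f : Lp ℝ 2 (P₀.prod Q₀ : Measure (Ω₁ × Ω₂))}
    (hf : f ∈ tangentSpace (P₀.prod Q₀) (productFamily ℱ₁ ℱ₂)) {A : Set Ω₁} {B : Set Ω₂}
    (hA : MeasurableSet A) (hB : MeasurableSet B) :
    ∫ z in A ×ˢ B, f z ∂(P₀.prod Q₀ : Measure (Ω₁ × Ω₂))
      = (Q₀ : Measure Ω₂).real B * ∫ z in A ×ˢ Set.univ, f z ∂(P₀.prod Q₀ : Measure (Ω₁ × Ω₂))
        + (P₀ : Measure Ω₁).real A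
          * ∫ z in Set.univ ×ˢ B, f z ∂(P₀.prod Q₀ : Measure (Ω₁ × Ω₂)) := by
  set μ : Measure (Ω₁ × Ω₂) := (P₀.prod Q₀ : Measure (Ω₁ × Ω₂)) with hμ
  -- the product rule for `A × B` says exactly that the element is orthogonal to `v`
  let v : Lp ℝ 2 μ := indicatorConstLp 2 (hA.prod hB) (measure_ne_top μ _) (1 : ℝ)
    - (Q₀ : Measure Ω₂).real B
      • indicatorConstLp 2 (hA.prod MeasurableSet.univ) (measure_ne_top μ _) (1 : ℝ)
    - (P₀ : Measure Ω₁).real A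
      • indicatorConstLp 2 (MeasurableSet.univ.prod hB) (measure_ne_top μ _) (1 : ℝ)
  have hv : ∀ e : Lp ℝ 2 μ, inner ℝ v e = ∫ z in A ×ˢ B, e z ∂μ
      - (Q₀ : Measure Ω₂).real B * ∫ z in A ×ˢ Set.univ, e z ∂μ
      - (P₀ : Measure Ω₁).real A * ∫ z in Set.univ ×ˢ B, e z ∂μ := by
    intro e
    simp only [v, inner_sub_left, real_inner_smul_left, L2.inner_indicatorConstLp_one]
  have hle : tangentSpace (P₀.prod Q₀) (productFamily ℱ₁ ℱ₂) ≤ (Submodule.span ℝ {v})ᗮ := by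
    refine Submodule.topologicalClosure_minimal _ (Submodule.span_le.2 ?_)
      (Submodule.isClosed_orthogonal _)
    rintro e ⟨-, p, hp0, hp⟩
    rw [SetLike.mem_coe, Submodule.mem_orthogonal_singleton_iff_inner_right, hv,
      hp.setIntegral_prod_eq hp0 hA hB]
    ring
  have h := Submodule.mem_orthogonal_singleton_iff_inner_right.1 (hle hf)
  rw [hv] at h
  linarith

/-- A function satisfying the product rule is the sum of its two conditional expectations. -/
theorem ae_eq_add_component {P₀ : ProbabilityMeasure Ω₁} {Q₀ : ProbabilityMeasure Ω₂}
    {f : Ω₁ × Ω₂ → ℝ} (hf : Integrable f (P₀.prod Q₀ : Measure (Ω₁ × Ω₂)))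
    (h : ∀ (A : Set Ω₁) (B : Set Ω₂), MeasurableSet A → MeasurableSet B →
      ∫ z in A ×ˢ B, f z ∂(P₀.prod Q₀ : Measure (Ω₁ × Ω₂))
      = (Q₀ : Measure Ω₂).real B * ∫ z in A ×ˢ Set.univ, f z ∂(P₀.prod Q₀ : Measure (Ω₁ × Ω₂))
        + (P₀ : Measure Ω₁).real A
          * ∫ z in Set.univ ×ˢ B, f z ∂(P₀.prod Q₀ : Measure (Ω₁ × Ω₂))) :
    ∀ᵐ z ∂(P₀.prod Q₀ : Measure (Ω₁ × Ω₂)),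
      f z = component₁ f Q₀ z.1 + component₂ f P₀ z.2 := by
  rw [ProbabilityMeasure.toMeasure_prod] at *
  have i1 : Integrable (component₁ f Q₀) (P₀ : Measure Ω₁) := hf.integral_prod_left
  have i2 : Integrable (component₂ f P₀) (Q₀ : Measure Ω₂) := hf.integral_prod_right
  have j1 : Integrable (fun z : Ω₁ × Ω₂ => component₁ f Q₀ z.1)
      ((P₀ : Measure Ω₁).prod (Q₀ : Measure Ω₂)) := i1.comp_fst _
  have j2 : Integrable (fun z : Ω₁ × Ω₂ => component₂ f P₀ z.2)
      ((P₀ : Measure Ω₁).prod (Q₀ : Measure Ω₂)) := i2.comp_snd _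
  have j12 : Integrable (fun z : Ω₁ × Ω₂ => component₁ f Q₀ z.1 + component₂ f P₀ z.2)
      ((P₀ : Measure Ω₁).prod (Q₀ : Measure Ω₂)) := j1.add j2
  have hrect : ∀ (A : Set Ω₁) (B : Set Ω₂), MeasurableSet A → MeasurableSet B →
      ∫ z in A ×ˢ B, f z ∂((P₀ : Measure Ω₁).prod (Q₀ : Measure Ω₂))
      = ∫ z in A ×ˢ B, (component₁ f Q₀ z.1 + component₂ f P₀ z.2)
        ∂((P₀ : Measure Ω₁).prod (Q₀ : Measure Ω₂)) := by
    intro A B hA hB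
    rw [h A B hA hB, integral_add j1.integrableOn j2.integrableOn]
    have e1 := setIntegral_prod_mul (μ := (P₀ : Measure Ω₁)) (ν := (Q₀ : Measure Ω₂))
      (component₁ f Q₀) (fun _ => (1 : ℝ)) A B
    have e2 := setIntegral_prod_mul (μ := (P₀ : Measure Ω₁)) (ν := (Q₀ : Measure Ω₂))
      (fun _ => (1 : ℝ)) (component₂ f P₀) A B
    simp only [mul_one, one_mul, integral_const, smul_eq_mul, measureReal_restrict_apply_univ]
      at e1 e2
    rw [e1, e2, setIntegral_prod _ hf.integrableOn, ← setIntegral_prod_swap,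
      setIntegral_prod (fun z : Ω₂ × Ω₁ => f z.swap) hf.swap.integrableOn]
    simp only [Measure.restrict_univ, component₁, component₂, Prod.swap_prod_mk]
    ring
  refine hf.ae_eq_of_withDensityᵥ_eq j12 ?_
  refine VectorMeasure.ext_of_generateFrom _ ?_ generateFrom_prod.symm isPiSystem_prod ?_
  · rintro _ ⟨A, hA, B, hB, rfl⟩
    rw [withDensityᵥ_apply hf (MeasurableSet.prod hA hB),
      withDensityᵥ_apply j12 (MeasurableSet.prod hA hB)]
    exact hrect A B hA hB
  · rw [withDensityᵥ_apply hf MeasurableSet.univ, withDensityᵥ_apply j12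
      MeasurableSet.univ, ← Set.univ_prod_univ]
    exact hrect _ _ MeasurableSet.univ MeasurableSet.univ

end Product

/-! ### Powers and rates -/

/-- A triangular version of `(1 + w / m) ^ m → exp w`. -/
theorem tendsto_one_add_pow_exp {m : ℕ → ℕ} {z : ℕ → ℂ} {w : ℂ} (hm : Tendsto m atTop atTop)
    (hz : Tendsto (fun n => (m n : ℂ) * z n) atTop (𝓝 w)) :
    Tendsto (fun n => (1 + z n) ^ m n) atTop (𝓝 (Complex.exp w)) := by
  have hm' : Tendsto (fun n => (m n : ℝ)) atTop atTop := tendsto_natCast_atTop_atTop.comp hm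
  have hz0 : Tendsto z atTop (𝓝 0) := by
    have h1 : Tendsto (fun n => ((m n : ℝ)⁻¹ : ℂ)) atTop (𝓝 ((0 : ℝ) : ℂ)) := by
      have := (Complex.continuous_ofReal.tendsto 0).comp (tendsto_inv_atTop_zero.comp hm')
      simpa [Function.comp_def] using this
    have h2 := h1.mul hz
    rw [Complex.ofReal_zero, zero_mul] at h2
    refine h2.congr' ?_
    filter_upwards [hm.eventually_gt_atTop 0] with n hn
    have : (m n : ℂ) ≠ 0 := Nat.cast_ne_zero.2 hn.ne'
    simp only [Complex.ofReal_natCast]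
    field_simp
  have hsmall : ∀ᶠ n in atTop, ‖z n‖ ≤ 1 / 2 := by
    have := hz0.norm
    rw [norm_zero] at this
    exact this.eventually_le_const (by norm_num)
  have hlog : Tendsto (fun n => (m n : ℂ) * Complex.log (1 + z n)) atTop (𝓝 w) := by
    refine hz.congr_dist (squeeze_zero' (g := fun n => ‖(m n : ℂ) * z n‖ * ‖z n‖)
      (Eventually.of_forall fun _ => dist_nonneg) ?_ ?_)
    · filter_upwards [hsmall] with n hn
      rw [dist_comm, dist_eq_norm, ← mul_sub, norm_mul, norm_mul, mul_assoc]
      refine mul_le_mul_of_nonneg_left ?_ (norm_nonneg _)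
      refine (Complex.norm_log_one_add_sub_self_le (by linarith)).trans ?_
      have : (1 - ‖z n‖)⁻¹ ≤ 2 := by
        rw [inv_le_comm₀ (by linarith) (by norm_num)]
        linarith
      nlinarith [sq_nonneg ‖z n‖]
    · simpa using hz.norm.mul hz0.norm
  refine ((Complex.continuous_exp.tendsto _).comp hlog).congr' ?_
  filter_upwards [hsmall] with n hn
  have hne : 1 + z n ≠ 0 := fun h => by
    have : z n = -1 := by linear_combination h
    rw [this] at hn
    norm_num at hn
  rw [Function.comp_apply, Complex.exp_nat_mul, Complex.exp_log hne]

theorem tendsto_of_tendsto_sqrt_mul {c : ℕ → ℝ} {s : ℝ}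
    (hc : Tendsto (fun n : ℕ => √(n : ℝ) * c n) atTop (𝓝 s)) : Tendsto c atTop (𝓝 0) := by
  have h1 : Tendsto (fun n : ℕ => (√(n : ℝ))⁻¹) atTop (𝓝 0) :=
    tendsto_inv_atTop_zero.comp (Real.tendsto_sqrt_atTop.comp tendsto_natCast_atTop_atTop)
  have h2 := h1.mul hc
  rw [zero_mul] at h2
  refine h2.congr' ?_
  filter_upwards [eventually_gt_atTop 0] with n hn
  have : √(n : ℝ) ≠ 0 := (Real.sqrt_pos.2 (Nat.cast_pos.2 hn)).ne'
  field_simp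

/-! ### Characteristic functions along `L₂`-differentiable curves -/

section CharFun

variable {Ω : Type*} [MeasurableSpace Ω]

/-- Second-order expansion of the characteristic function of a centred square-integrable random
variable at arguments of order `1 / √n`. -/
theorem tendsto_mul_charFun_sub_one {μ : Measure Ω} [IsProbabilityMeasure μ] {f : Ω → ℝ}
    (hf : MemLp f 2 μ) (h0 : ∫ ω, f ω ∂μ = 0) {c : ℕ → ℝ} {s : ℝ}
    (hc : Tendsto (fun n : ℕ => √(n : ℝ) * c n) atTop (𝓝 s)) :
    Tendsto (fun n : ℕ => (n : ℂ) * (charFun (μ.map f) (c n) - 1)) atTop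
      (𝓝 (-(s ^ 2 / 2 * ∫ ω, f ω ^ 2 ∂μ : ℝ))) := by
  have hfm : AEMeasurable f μ := hf.1.aemeasurable
  have hprob : IsProbabilityMeasure (μ.map f) := Measure.isProbabilityMeasure_map hfm
  have hid : MemLp id 2 (μ.map f) := by
    rw [memLp_map_measure_iff aestronglyMeasurable_id hfm]
    simpa using hf
  have htay : (fun x : ℝ => charFun (μ.map f) x - taylorWithinEval (charFun (μ.map f)) 2
      Set.univ 0 x) =o[𝓝 0] fun x => x ^ 2 := by
    simpa using taylor_isLittleO_univ (x₀ := (0 : ℝ)) (contDiff_charFun (n := 2) hid)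
  have hc0 := tendsto_of_tendsto_sqrt_mul hc
  have hsq : Tendsto (fun n : ℕ => (n : ℝ) * c n ^ 2) atTop (𝓝 (s ^ 2)) := by
    refine (hc.pow 2).congr fun n => ?_
    rw [mul_pow, Real.sq_sqrt (Nat.cast_nonneg n)]
  have hrem : Tendsto (fun n : ℕ => (n : ℂ) * (charFun (μ.map f) (c n)
      - taylorWithinEval (charFun (μ.map f)) 2 Set.univ 0 (c n))) atTop (𝓝 0) := by
    refine (isLittleO_one_iff ℝ).1 ?_
    have hn : (fun n : ℕ => (n : ℂ)) =O[atTop] fun n : ℕ => (n : ℝ) :=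
      IsBigO.of_bound 1 (Eventually.of_forall fun n => by simp)
    exact (hn.mul_isLittleO (htay.comp_tendsto hc0)).trans_isBigO (hsq.isBigO_one ℝ)
  have hmain : Tendsto (fun n : ℕ => ((-((n : ℝ) * c n ^ 2 / 2 * ∫ ω, f ω ^ 2 ∂μ) : ℝ) : ℂ))
      atTop (𝓝 (-(s ^ 2 / 2 * ∫ ω, f ω ^ 2 ∂μ) : ℝ)) :=
    (Complex.continuous_ofReal.tendsto _).comp ((hsq.div_const 2).mul_const _).neg
  have := hrem.add hmain
  rw [zero_add, Complex.ofReal_neg] at this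
  refine this.congr fun n => ?_
  rw [taylorWithinEval_charFun_two_zero hfm hid, h0]
  simp only [Pi.pow_apply]
  push_cast
  ring

/-- Along an `L₂`-differentiable curve and at the rate `t n ~ τ / √n`, the tangent `g` shifts the
expansion of the characteristic function of `f` by the drift `τ ∫ f g`. -/
theorem IsL2Curve.tendsto_mul_charFun_sub_one {ℱ : Set (ProbabilityMeasure Ω)}
    {p : ℝ → ProbabilityMeasure Ω} {g : Ω → ℝ} (hp : IsL2Curve ℱ p g) {t : ℕ → ℝ} {τ : ℝ}
    (ht : Tendsto (fun n : ℕ => √(n : ℝ) * t n) atTop (𝓝 τ)) {f : Ω → ℝ} (hfm : Measurable f)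
    (hf : MemLp f 2 (p 0 : Measure Ω)) (h0 : ∫ ω, f ω ∂(p 0 : Measure Ω) = 0) {c : ℕ → ℝ} {s : ℝ}
    (hc : Tendsto (fun n : ℕ => √(n : ℝ) * c n) atTop (𝓝 s)) :
    Tendsto (fun n : ℕ => (n : ℂ) * (charFun ((p (t n) : Measure Ω).map f) (c n) - 1)) atTop
      (𝓝 (s * τ * (∫ ω, f ω * g ω ∂(p 0 : Measure Ω) : ℝ) * Complex.I
        - (s ^ 2 / 2 * ∫ ω, f ω ^ 2 ∂(p 0 : Measure Ω) : ℝ))) := by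
  set h : ℕ → Ω → ℂ := fun n ω => Complex.exp (Complex.I * ((c n * f ω : ℝ) : ℂ)) - 1 with hh
  have hm : ∀ n, Measurable (h n) := fun n => by fun_prop
  have hle : ∀ n ω, ‖h n ω‖ ≤ |c n * f ω| := fun n ω => Real.norm_exp_I_mul_ofReal_sub_one_le
  have hexp1 : ∀ x : ℝ, ‖Complex.exp (Complex.I * (x : ℂ))‖ = 1 := fun x => by
    rw [mul_comm]; exact Complex.norm_exp_ofReal_mul_I x
  have hle2 : ∀ n ω, ‖h n ω‖ ≤ 2 := fun n ω => by
    refine (norm_sub_le _ _).trans ?_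
    rw [hexp1, norm_one]
    norm_num
  have hchar : ∀ (μ : Measure Ω) [IsProbabilityMeasure μ] (n : ℕ),
      ∫ ω, h n ω ∂μ = charFun (μ.map f) (c n) - 1 := by
    intro μ _ n
    have hi : Integrable (fun ω => Complex.exp (Complex.I * ((c n * f ω : ℝ) : ℂ))) μ :=
      Integrable.of_bound (by fun_prop) 1 (ae_of_all _ fun ω => (hexp1 _).le)
    rw [charFun_apply_real, integral_map hfm.aemeasurable (by fun_prop)]
    simp only [hh]
    rw [integral_sub hi (integrable_const _)]
    simp only [integral_const, probReal_univ, one_smul, sub_left_inj]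
    refine integral_congr_ae (ae_of_all _ fun ω => ?_)
    simp only
    congr 1
    push_cast
    ring
  have hc0 := tendsto_of_tendsto_sqrt_mul hc
  have hcf : ∀ ω, Tendsto (fun n => c n * f ω) atTop (𝓝 0) := fun ω => by
    simpa using hc0.mul_const (f ω)
  have hh0 : ∀ ω, Tendsto (fun n => h n ω) atTop (𝓝 0) := fun ω =>
    squeeze_zero_norm (fun n => hle n ω) (by simpa using (hcf ω).abs)
  have hratio : ∀ n : ℕ, |√(n : ℝ) / √(n : ℝ)| ≤ 1 := fun n => by
    rw [abs_of_nonneg (by positivity)]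
    exact div_self_le_one _
  -- `K` provides the dominating function for the `L₂`-convergence of `√n * h n`
  obtain ⟨K, hK⟩ := hc.norm.bddAbove_range
  have hK' : ∀ n : ℕ, ‖√(n : ℝ) * c n‖ ≤ K := fun n => hK ⟨n, rfl⟩
  have key := hp.tendsto_integral_sub (t := t) (a := fun n => √(n : ℝ)) (b := fun n => √(n : ℝ))
    (h := h) (H := fun ω => (s : ℂ) * Complex.I * (f ω : ℂ)) (tendsto_of_tendsto_sqrt_mul ht) ht
    ((eventually_gt_atTop 0).mono fun n hn => (Real.sqrt_pos.2 (Nat.cast_pos.2 hn)).ne')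
    hratio hm hle2 (hf.ofReal.const_mul _)
    (by
      refine tendsto_eLpNorm_sub_of_dominated (G := fun ω => (K + |s|) * ‖f ω‖)
        (fun n => ((hm n).const_mul _).aestronglyMeasurable)
        (hf.ofReal.const_mul _).1 (hf.norm.const_mul _) (fun n => ae_of_all _ fun ω => ?_)
        (ae_of_all _ fun ω => ?_)
      · rw [add_mul]
        refine (norm_sub_le _ _).trans (add_le_add ?_ ?_)
        · rw [norm_mul, Complex.norm_real]
          calc _ ≤ ‖√(n : ℝ)‖ * |c n * f ω| :=
                mul_le_mul_of_nonneg_left (hle n ω) (norm_nonneg _)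
            _ = ‖√(n : ℝ) * c n‖ * ‖f ω‖ := by
                rw [abs_mul, norm_mul, ← Real.norm_eq_abs, ← Real.norm_eq_abs, mul_assoc]
            _ ≤ K * ‖f ω‖ := mul_le_mul_of_nonneg_right (hK' n) (norm_nonneg _)
        · simp
      · have hlin : Tendsto (fun n : ℕ => ((√(n : ℝ) * c n : ℝ) : ℂ) * Complex.I * (f ω : ℂ)) atTop
            (𝓝 ((s : ℂ) * Complex.I * (f ω : ℂ))) :=
          (((Complex.continuous_ofReal.tendsto s).comp hc).mul_const _).mul_const _
        have hq : Tendsto (fun n : ℕ => (√(n : ℝ) * c n * f ω) * (c n * f ω)) atTop (𝓝 0) := by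
          simpa using (hc.mul_const (f ω)).mul (hcf ω)
        have hq' := hq.norm
        rw [norm_zero] at hq'
        refine hlin.congr_dist (squeeze_zero' (Eventually.of_forall fun _ => dist_nonneg) ?_ hq')
        have hsm := (hcf ω).norm
        rw [norm_zero] at hsm
        filter_upwards [hsm.eventually_le_const one_pos] with n hn
        have hb := Complex.norm_exp_sub_one_sub_id_le
          (x := Complex.I * ((c n * f ω : ℝ) : ℂ)) (by simpa using hn)
        rw [dist_comm, dist_eq_norm]
        have e : (√(n : ℝ) : ℂ) * h n ω - ((√(n : ℝ) * c n : ℝ) : ℂ) * Complex.I * (f ω : ℂ)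
            = (√(n : ℝ) : ℂ) * (Complex.exp (Complex.I * ((c n * f ω : ℝ) : ℂ)) - 1
              - Complex.I * ((c n * f ω : ℝ) : ℂ)) := by
          simp only [hh]
          push_cast
          ring
        rw [e, norm_mul, Complex.norm_real]
        refine (mul_le_mul_of_nonneg_left hb (norm_nonneg _)).trans (le_of_eq ?_)
        rw [norm_mul Complex.I, Complex.norm_I, one_mul, Complex.norm_real, ← norm_pow, ← norm_mul]
        congr 1
        ring)
    (fun ω => by
      refine squeeze_zero_norm (fun n => ?_) (by simpa using (hh0 ω).norm)
      rw [norm_mul, Complex.norm_real]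
      exact mul_le_of_le_one_left (norm_nonneg _) (hratio n))
  simp only [hchar, Real.mul_self_sqrt (Nat.cast_nonneg _)] at key
  have h2 := key.add (TwoSample.tendsto_mul_charFun_sub_one hf h0 hc)
  have hval : (τ : ℂ) * ∫ ω, (s : ℂ) * Complex.I * (f ω : ℂ) * (g ω : ℂ) ∂(p 0 : Measure Ω)
      = s * τ * (∫ ω, f ω * g ω ∂(p 0 : Measure Ω) : ℝ) * Complex.I := by
    rw [← integral_complex_ofReal]
    simp only [mul_assoc, integral_const_mul, Complex.ofReal_mul]
    ring
  rw [hval, ← sub_eq_add_neg] at h2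
  refine h2.congr fun n => ?_
  push_cast
  ring

end CharFun

/-! ### Two independent samples -/

section Samples

variable {Ω₁ Ω₂ : Type*} [MeasurableSpace Ω₁] [MeasurableSpace Ω₂]

instance (P : ProbabilityMeasure Ω₁) (Q : ProbabilityMeasure Ω₂) (n₁ n₂ : ℕ) :
    IsProbabilityMeasure (sampleLaw P Q n₁ n₂) := by
  unfold sampleLaw
  infer_instance

/-- The weighted sum of two sample sums, the additive form of the two-sample statistic. -/
def additiveStatistic (f₁ : Ω₁ → ℝ) (f₂ : Ω₂ → ℝ) (n₁ n₂ : ℕ) (a₁ a₂ : ℝ)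
    (ω : (Fin n₁ → Ω₁) × (Fin n₂ → Ω₂)) : ℝ :=
  a₁ * ∑ i, f₁ (ω.1 i) + a₂ * ∑ j, f₂ (ω.2 j)

theorem measurable_additiveStatistic {f₁ : Ω₁ → ℝ} {f₂ : Ω₂ → ℝ} (h₁ : Measurable f₁)
    (h₂ : Measurable f₂) (n₁ n₂ : ℕ) (a₁ a₂ : ℝ) :
    Measurable (additiveStatistic f₁ f₂ n₁ n₂ a₁ a₂) := by
  unfold additiveStatistic
  fun_prop

theorem charFun_additiveStatistic {f₁ : Ω₁ → ℝ} {f₂ : Ω₂ → ℝ} (h₁ : Measurable f₁)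
    (h₂ : Measurable f₂) (P : ProbabilityMeasure Ω₁) (Q : ProbabilityMeasure Ω₂) (n₁ n₂ : ℕ)
    (a₁ a₂ s : ℝ) :
    charFun ((sampleLaw P Q n₁ n₂).map (additiveStatistic f₁ f₂ n₁ n₂ a₁ a₂)) s
      = charFun ((P : Measure Ω₁).map f₁) (s * a₁) ^ n₁
        * charFun ((Q : Measure Ω₂).map f₂) (s * a₂) ^ n₂ := by
  have hm := measurable_additiveStatistic h₁ h₂ n₁ n₂ a₁ a₂
  simp only [charFun_apply_real]
  rw [integral_map hm.aemeasurable (by fun_prop), integral_map h₁.aemeasurable (by fun_prop),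
    integral_map h₂.aemeasurable (by fun_prop)]
  have e1 := integral_fintype_prod_eq_pow (ι := Fin n₁) (μ := (P : Measure Ω₁))
    (fun x => Complex.exp (((s * a₁ : ℝ) : ℂ) * (f₁ x : ℂ) * Complex.I))
  have e2 := integral_fintype_prod_eq_pow (ι := Fin n₂) (μ := (Q : Measure Ω₂))
    (fun x => Complex.exp (((s * a₂ : ℝ) : ℂ) * (f₂ x : ℂ) * Complex.I))
  rw [Fintype.card_fin] at e1 e2
  rw [← e1, ← e2, ← integral_prod_mul, sampleLaw]
  refine integral_congr_ae (ae_of_all _ fun ω => ?_)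
  simp only [additiveStatistic]
  rw [← Complex.exp_sum, ← Complex.exp_sum, ← Complex.exp_add]
  congr 1
  push_cast
  simp only [Finset.mul_sum, Finset.sum_mul, mul_add, add_mul]
  congr 1 <;> refine Finset.sum_congr rfl fun i _ => ?_ <;> ring

end Samples

/-! ### The standard normal distribution -/

section Normal

theorem continuous_stdNormalCDF : Continuous stdNormalCDF := by
  have : NullSingletonClass (gaussianReal 0 1) := nullSingletonClass_gaussianReal one_ne_zero
  refine continuous_iff_continuousAt.2 fun x => ?_
  rw [show stdNormalCDF = cdf (gaussianReal 0 1) from rfl,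
    (monotone_cdf _).continuousAt_iff_leftLim_eq_rightLim, StieltjesFunction.rightLim_eq]
  have h : (cdf (gaussianReal 0 1)).measure {x} = 0 := by
    rw [measure_cdf]
    exact measure_singleton x
  rw [StieltjesFunction.measure_singleton, ENNReal.ofReal_eq_zero] at h
  exact le_antisymm ((monotone_cdf _).leftLim_le le_rfl) (by linarith)

theorem stdNormalCDF_stdNormalQuantile {q : ℝ} (h0 : 0 < q) (h1 : q < 1) :
    stdNormalCDF (stdNormalQuantile q) = q := by
  have hmono : Monotone stdNormalCDF := monotone_cdf _
  have hbot : Tendsto stdNormalCDF atBot (𝓝 0) := tendsto_cdf_atBot _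
  have htop : Tendsto stdNormalCDF atTop (𝓝 1) := tendsto_cdf_atTop _
  obtain ⟨x, hx⟩ : ∃ x, stdNormalCDF x = q :=
    mem_range_of_exists_le_of_exists_ge continuous_stdNormalCDF
      (hbot.eventually_le_const h0).exists (htop.eventually_const_le h1).exists
  obtain ⟨y, hy⟩ := (hbot.eventually_lt_const h0).exists
  have hbdd : BddBelow {x : ℝ | q ≤ stdNormalCDF x} :=
    ⟨y, fun z hz => le_of_lt (hmono.reflect_lt (hy.trans_le hz))⟩
  refine le_antisymm ((hmono (csInf_le hbdd hx.ge)).trans hx.le) ?_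
  exact (isClosed_le continuous_const continuous_stdNormalCDF).csInf_mem ⟨x, hx.ge⟩ hbdd

theorem stdNormalCDF_neg (x : ℝ) : stdNormalCDF (-x) = 1 - stdNormalCDF x := by
  have : NullSingletonClass (gaussianReal 0 1) := nullSingletonClass_gaussianReal one_ne_zero
  rw [stdNormalCDF, stdNormalCDF, cdf_eq_real, cdf_eq_real, ← probReal_compl_eq_one_sub
    measurableSet_Iic, Set.compl_Iic, measureReal_congr Ioi_ae_eq_Ici]
  have h : (gaussianReal 0 1).map (fun x => -x) = gaussianReal 0 1 := by
    rw [gaussianReal_map_neg, neg_zero]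
  conv_rhs => rw [← h, map_measureReal_apply measurable_neg measurableSet_Ici]
  simp

/-- Upper tail probabilities of a normal distribution at multiples of its standard deviation. -/
theorem gaussianReal_real_Ioi (m : ℝ) {v : ℝ} (hv : 0 < v) (u : ℝ) :
    (gaussianReal m v.toNNReal).real (Set.Ioi (u * √v)) = stdNormalCDF (m * (√v)⁻¹ - u) := by
  have : NullSingletonClass (gaussianReal 0 1) := nullSingletonClass_gaussianReal one_ne_zero
  have hs : 0 < √v := Real.sqrt_pos.2 hv
  have h : gaussianReal m v.toNNReal = (gaussianReal 0 1).map (fun x => -√v * x + m) := by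
    have h1 : (gaussianReal 0 1).map (fun x => -√v * x + m)
        = ((gaussianReal 0 1).map (-√v * ·)).map (· + m) := by
      rw [Measure.map_map (by fun_prop) (by fun_prop)]
      rfl
    rw [h1, gaussianReal_map_const_mul, gaussianReal_map_add_const, mul_zero, zero_add, mul_one]
    congr 1
    ext
    simp [Real.sq_sqrt hv.le, hv.le]
  rw [h, map_measureReal_apply (by fun_prop) measurableSet_Ioi, stdNormalCDF, cdf_eq_real,
    ← measureReal_congr (Iio_ae_eq_Iic (μ := gaussianReal 0 1))]
  congr 1
  ext x
  simp only [Set.mem_preimage, Set.mem_Ioi, Set.mem_Iio]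
  rw [← div_eq_mul_inv, lt_sub_iff_add_lt, lt_div_iff₀ hs]
  constructor <;> intro h <;> linarith

end Normal

/-! ### The rate of the local parameters -/

section Rate

variable {Ω : Type*} [MeasurableSpace Ω] {ℱ : Set (ProbabilityMeasure Ω)}
  {p : ℝ → ProbabilityMeasure Ω} {g : Ω → ℝ}

/-- Reversing the time of an `L₂`-differentiable curve changes the sign of its tangent. -/
theorem IsL2Curve.comp_neg (hc : IsL2Curve ℱ p g) :
    IsL2Curve ℱ (fun t => p (-t)) (fun ω => -g ω) := by
  have hneg : Tendsto (fun t : ℝ => -t) (𝓝 0) (𝓝 0) := by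
    simpa using (continuous_neg (G := ℝ)).tendsto 0
  obtain ⟨ε, hε, hmem⟩ := hc.mem_family
  refine ⟨⟨ε, hε, fun t ht => hmem (-t) (by rwa [abs_neg])⟩, ?_, ?_, ?_⟩
  · rw [neg_zero]
    exact hc.memLp.neg
  · have := hc.expansion.comp_tendsto hneg
    simpa [Function.comp_def] using this
  · have := hc.singular.comp_tendsto hneg
    simpa [Function.comp_def] using this

/-- A differentiable functional has a two-sided derivative along every `L₂`-differentiable
curve. -/
theorem IsGradient.tendsto_nhdsNE {k : ProbabilityMeasure Ω → ℝ} {κ : Ω → ℝ}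
    (hκ : IsGradient ℱ k (p 0) κ) (hc : IsL2Curve ℱ p g) :
    Tendsto (fun t : ℝ => (k (p t) - k (p 0)) / t) (𝓝[≠] 0)
      (𝓝 (∫ ω, κ ω * g ω ∂(p 0 : Measure Ω))) := by
  rw [← nhdsLT_sup_nhdsGT, tendsto_sup]
  constructor
  · have h := hκ.tendsto (fun t => p (-t)) (fun ω => -g ω) (by simp) hc.comp_neg
    have hneg : Tendsto (fun t : ℝ => -t) (𝓝[<] 0) (𝓝[>] 0) := by
      simpa using tendsto_neg_nhdsLT (a := (0 : ℝ))
    have h' := (h.comp hneg).neg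
    simp only [mul_neg, integral_neg, neg_neg] at h'
    refine h'.congr fun t => ?_
    simp only [Function.comp_apply, neg_neg, neg_zero]
    rw [one_div, inv_neg]
    ring
  · refine (hκ.tendsto p g rfl hc).congr fun t => ?_
    ring

/-- If the values of the functional are of order `ϑ / √n` along the curve, the parameters
satisfy `t n ~ (ϑ / ∫ κ g) / √n`. -/
theorem IsGradient.tendsto_sqrt_mul {k : ProbabilityMeasure Ω → ℝ} {κ : Ω → ℝ}
    (hκ : IsGradient ℱ k (p 0) κ) (hc : IsL2Curve ℱ p g)
    (hκg : ∫ ω, κ ω * g ω ∂(p 0 : Measure Ω) ≠ 0) {ϑ : ℝ} (hϑ : ϑ ≠ 0) {t : ℕ → ℝ}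
    (ht : Tendsto t atTop (𝓝 0))
    (hk : (fun n : ℕ => k (p (t n)) - (k (p 0) + (n : ℝ) ^ (-(1 / 2) : ℝ) * ϑ))
      =o[atTop] (fun n : ℕ => (n : ℝ) ^ (-(1 / 2) : ℝ))) :
    Tendsto (fun n : ℕ => √(n : ℝ) * t n) atTop
      (𝓝 (ϑ / ∫ ω, κ ω * g ω ∂(p 0 : Measure Ω))) := by
  have hΔ : Tendsto (fun n : ℕ => √(n : ℝ) * (k (p (t n)) - k (p 0))) atTop (𝓝 ϑ) := by
    have h1 := hk.tendsto_div_nhds_zero.add_const ϑ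
    rw [zero_add] at h1
    refine h1.congr' ?_
    filter_upwards [eventually_gt_atTop 0] with n hn
    have hs : 0 < √(n : ℝ) := Real.sqrt_pos.2 (Nat.cast_pos.2 hn)
    rw [Real.rpow_neg (Nat.cast_nonneg n), ← Real.sqrt_eq_rpow]
    field_simp
    ring
  -- `ϑ ≠ 0` keeps the parameters away from `0`, where the difference quotient is undefined
  have hne : ∀ᶠ n in atTop, k (p (t n)) - k (p 0) ≠ 0 :=
    (hΔ.eventually_ne hϑ).mono fun n hn h => hn (by rw [h, mul_zero])
  have ht' : Tendsto t atTop (𝓝[≠] 0) :=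
    tendsto_nhdsWithin_iff.2 ⟨ht, hne.mono fun n hn h => hn (by
      rw [Set.mem_singleton_iff.1 h, sub_self])⟩
  refine (hΔ.div ((hκ.tendsto_nhdsNE hc).comp ht') hκg).congr' ?_
  filter_upwards [hne, ht'.eventually self_mem_nhdsWithin] with n hn hn'
  have hn'' : t n ≠ 0 := hn'
  simp only [Pi.div_apply, Function.comp_apply]
  field_simp

end Rate

/-! ### Singular observations -/

section Singular

/-- Off the set where the density quotient is infinite, `P` is dominated by `Q`. -/
theorem restrict_compl_absolutelyContinuous {Ω : Type*} [MeasurableSpace Ω] (P Q : Measure Ω)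
    [IsFiniteMeasure P] [IsFiniteMeasure Q] :
    P.restrict {ω | densityQuotient P Q ω = ∞}ᶜ ≪ Q := by
  have hS := measurableSet_densityQuotient_eq_top P Q
  have h := congrArg (Measure.restrict · {ω | densityQuotient P Q ω = ∞}ᶜ)
    (eq_withDensity_densityQuotient_add_restrict P Q)
  simp only [Measure.restrict_add, Measure.restrict_restrict hS.compl, Set.compl_inter_self,
    Measure.restrict_empty, add_zero] at h
  rw [h]
  exact Measure.restrict_le_self.absolutelyContinuous.trans (withDensity_absolutelyContinuous _ _)

theorem measure_densityQuotient_eq_top {Ω : Type*} [MeasurableSpace Ω] (P Q : Measure Ω)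
    [IsFiniteMeasure P] [IsFiniteMeasure Q] : Q {ω | densityQuotient P Q ω = ∞} = 0 := by
  have := ae_densityQuotient_lt_top P Q
  rw [ae_iff] at this
  simpa using this

variable {Ω₁ Ω₂ : Type*} [MeasurableSpace Ω₁] [MeasurableSpace Ω₂]

/-- A relation between one observation from each sample that holds `P₀ ⊗ Q₀`-almost everywhere
fails for some pair with probability at most `n₁ + n₂` times the singular mass of `P ⊗ Q`. There
are `n₁ n₂` pairs, but only the singular parts of the `n₁ + n₂` individual observations matter. -/
theorem sampleLaw_exists_not_le {P P₀ : ProbabilityMeasure Ω₁} {Q Q₀ : ProbabilityMeasure Ω₂}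
    {r : Ω₁ × Ω₂ → Prop} (hr : MeasurableSet {z | r z})
    (h : ∀ᵐ z ∂(P₀.prod Q₀ : Measure (Ω₁ × Ω₂)), r z) (n₁ n₂ : ℕ) :
    sampleLaw P Q n₁ n₂ {ω | ∃ i j, ¬ r (ω.1 i, ω.2 j)}
      ≤ (n₁ + n₂) * (P.prod Q : Measure (Ω₁ × Ω₂)) {z | densityQuotient
        (P.prod Q : Measure (Ω₁ × Ω₂)) (P₀.prod Q₀ : Measure (Ω₁ × Ω₂)) z = ∞} := by
  set δ := (P.prod Q : Measure (Ω₁ × Ω₂)) {z | densityQuotient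
        (P.prod Q : Measure (Ω₁ × Ω₂)) (P₀.prod Q₀ : Measure (Ω₁ × Ω₂)) z = ∞} with hδ
  set S₁ := {x | densityQuotient (P : Measure Ω₁) (P₀ : Measure Ω₁) x = ∞} with hS₁
  set S₂ := {y | densityQuotient (Q : Measure Ω₂) (Q₀ : Measure Ω₂) y = ∞} with hS₂
  have mS₁ : MeasurableSet S₁ := measurableSet_densityQuotient_eq_top _ _
  have mS₂ : MeasurableSet S₂ := measurableSet_densityQuotient_eq_top _ _
  have b₁ : (P : Measure Ω₁) S₁ ≤ δ := by
    have h0 : (P₀.prod Q₀ : Measure (Ω₁ × Ω₂)) (S₁ ×ˢ Set.univ) = 0 := by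
      rw [ProbabilityMeasure.toMeasure_prod, Measure.prod_prod,
        measure_densityQuotient_eq_top, zero_mul]
    have := measure_le_of_measure_eq_zero (P.prod Q : Measure (Ω₁ × Ω₂)) _ h0
    rwa [← hδ, ProbabilityMeasure.toMeasure_prod, Measure.prod_prod, measure_univ,
      mul_one] at this
  have b₂ : (Q : Measure Ω₂) S₂ ≤ δ := by
    have h0 : (P₀.prod Q₀ : Measure (Ω₁ × Ω₂)) (Set.univ ×ˢ S₂) = 0 := by
      rw [ProbabilityMeasure.toMeasure_prod, Measure.prod_prod,
        measure_densityQuotient_eq_top, mul_zero]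
    have := measure_le_of_measure_eq_zero (P.prod Q : Measure (Ω₁ × Ω₂)) _ h0
    rwa [← hδ, ProbabilityMeasure.toMeasure_prod, Measure.prod_prod, measure_univ,
      one_mul] at this
  have bE : ((P : Measure Ω₁).prod (Q : Measure Ω₂)) ({z | ¬ r z} ∩ S₁ᶜ ×ˢ S₂ᶜ) = 0 := by
    have hac := (restrict_compl_absolutelyContinuous (P : Measure Ω₁) (P₀ : Measure Ω₁)).prod
      (restrict_compl_absolutelyContinuous (Q : Measure Ω₂) (Q₀ : Measure Ω₂))
    rw [← Measure.restrict_apply' (mS₁.compl.prod mS₂.compl), ← Measure.prod_restrict]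
    exact hac (by simpa [ae_iff] using h)
  have m₁ : ∀ i : Fin n₁, MeasurePreserving
      (fun ω : (Fin n₁ → Ω₁) × (Fin n₂ → Ω₂) => ω.1 i) (sampleLaw P Q n₁ n₂) (P : Measure Ω₁) :=
    fun i => (measurePreserving_eval _ i).comp measurePreserving_fst
  have m₂ : ∀ j : Fin n₂, MeasurePreserving
      (fun ω : (Fin n₁ → Ω₁) × (Fin n₂ → Ω₂) => ω.2 j) (sampleLaw P Q n₁ n₂) (Q : Measure Ω₂) :=
    fun j => (measurePreserving_eval _ j).comp measurePreserving_snd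
  have m₁₂ : ∀ (i : Fin n₁) (j : Fin n₂), MeasurePreserving
      (fun ω : (Fin n₁ → Ω₁) × (Fin n₂ → Ω₂) => (ω.1 i, ω.2 j)) (sampleLaw P Q n₁ n₂)
      ((P : Measure Ω₁).prod (Q : Measure Ω₂)) :=
    fun i j => (measurePreserving_eval (fun _ => (P : Measure Ω₁)) i).prod
      (measurePreserving_eval (fun _ => (Q : Measure Ω₂)) j)
  have hsub : {ω : (Fin n₁ → Ω₁) × (Fin n₂ → Ω₂) | ∃ i j, ¬ r (ω.1 i, ω.2 j)}
      ⊆ ((⋃ i, (fun ω => ω.1 i) ⁻¹' S₁) ∪ ⋃ j, (fun ω => ω.2 j) ⁻¹' S₂)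
        ∪ ⋃ i, ⋃ j, (fun ω => (ω.1 i, ω.2 j)) ⁻¹' ({z | ¬ r z} ∩ S₁ᶜ ×ˢ S₂ᶜ) := by
    rintro ω ⟨i, j, hij⟩
    by_cases h1 : ω.1 i ∈ S₁
    · exact Or.inl (Or.inl (Set.mem_iUnion.2 ⟨i, h1⟩))
    by_cases h2 : ω.2 j ∈ S₂
    · exact Or.inl (Or.inr (Set.mem_iUnion.2 ⟨j, h2⟩))
    exact Or.inr (Set.mem_iUnion.2 ⟨i, Set.mem_iUnion.2 ⟨j, hij, h1, h2⟩⟩)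
  have hz : sampleLaw P Q n₁ n₂
      (⋃ i, ⋃ j, (fun ω => (ω.1 i, ω.2 j)) ⁻¹' ({z | ¬ r z} ∩ S₁ᶜ ×ˢ S₂ᶜ)) = 0 := by
    refine measure_iUnion_null fun i => measure_iUnion_null fun j => ?_
    have hE : MeasurableSet ({z | ¬ r z} ∩ S₁ᶜ ×ˢ S₂ᶜ) :=
      hr.compl.inter (mS₁.compl.prod mS₂.compl)
    rw [(m₁₂ i j).measure_preimage hE.nullMeasurableSet, bE]
  calc sampleLaw P Q n₁ n₂ {ω | ∃ i j, ¬ r (ω.1 i, ω.2 j)}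
      ≤ (∑ _i : Fin n₁, δ + ∑ _j : Fin n₂, δ) + 0 := by
        refine (measure_mono hsub).trans ((measure_union_le _ _).trans ?_)
        rw [hz]
        gcongr
        refine (measure_union_le _ _).trans (add_le_add ?_ ?_)
        · refine (measure_iUnion_fintype_le _ _).trans (Finset.sum_le_sum fun i _ => ?_)
          rw [(m₁ i).measure_preimage mS₁.nullMeasurableSet]
          exact b₁
        · refine (measure_iUnion_fintype_le _ _).trans (Finset.sum_le_sum fun j _ => ?_)
          rw [(m₂ j).measure_preimage mS₂.nullMeasurableSet]
          exact b₂
    _ = (n₁ + n₂) * δ := by simp [add_mul]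

end Singular

/-! ### The components of the kernel and the test statistic -/

section Components

variable {Ω₁ Ω₂ : Type*} [MeasurableSpace Ω₁] [MeasurableSpace Ω₂]
  {P₀ : ProbabilityMeasure Ω₁} {Q₀ : ProbabilityMeasure Ω₂} {κ : Ω₁ × Ω₂ → ℝ}

theorem measurable_component₁ (hκ : Measurable κ) (Q₀ : ProbabilityMeasure Ω₂) :
    Measurable (component₁ κ Q₀) :=
  hκ.stronglyMeasurable.integral_prod_right'.measurable

theorem measurable_component₂ (hκ : Measurable κ) (P₀ : ProbabilityMeasure Ω₁) :
    Measurable (component₂ κ P₀) :=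
  hκ.stronglyMeasurable.integral_prod_left'.measurable

theorem integral_component₁ (hκ : Integrable κ (P₀.prod Q₀ : Measure (Ω₁ × Ω₂))) :
    ∫ x, component₁ κ Q₀ x ∂(P₀ : Measure Ω₁) = ∫ z, κ z ∂(P₀.prod Q₀ : Measure (Ω₁ × Ω₂)) :=
  (integral_prod κ hκ).symm

theorem integral_component₂ (hκ : Integrable κ (P₀.prod Q₀ : Measure (Ω₁ × Ω₂))) :
    ∫ y, component₂ κ P₀ y ∂(Q₀ : Measure Ω₂) = ∫ z, κ z ∂(P₀.prod Q₀ : Measure (Ω₁ × Ω₂)) :=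
  (integral_prod_symm κ hκ).symm

/-- The first summand of an additive square-integrable function is, up to a constant, a section
of it. -/
theorem memLp_component₁ (hm : Measurable κ) (hκ : MemLp κ 2 (P₀.prod Q₀ : Measure (Ω₁ × Ω₂)))
    (hadd : ∀ᵐ z ∂(P₀.prod Q₀ : Measure (Ω₁ × Ω₂)),
      κ z = component₁ κ Q₀ z.1 + component₂ κ P₀ z.2) :
    MemLp (component₁ κ Q₀) 2 (P₀ : Measure Ω₁) := by
  rw [ProbabilityMeasure.toMeasure_prod] at *
  have m1 := measurable_component₁ hm Q₀
  have m2 := measurable_component₂ hm P₀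
  have hset : MeasurableSet {z : Ω₁ × Ω₂ | κ z = component₁ κ Q₀ z.1 + component₂ κ P₀ z.2} :=
    measurableSet_eq_fun hm ((m1.comp measurable_fst).add (m2.comp measurable_snd))
  have h1 : ∀ᵐ y ∂(Q₀ : Measure Ω₂), ∀ᵐ x ∂(P₀ : Measure Ω₁),
      κ (x, y) = component₁ κ Q₀ x + component₂ κ P₀ y :=
    (Measure.ae_ae_comm hset).1 (Measure.ae_ae_of_ae_prod hadd)
  obtain ⟨y, hy, hy'⟩ := (h1.and hκ.integrable_sq.prod_left_ae).exists
  have hs : MemLp (fun x => κ (x, y) - component₂ κ P₀ y) 2 (P₀ : Measure Ω₁) := by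
    refine MemLp.sub ?_ (memLp_const _)
    exact (memLp_two_iff_integrable_sq
      (hm.comp measurable_prodMk_right).aestronglyMeasurable).2 hy'
  refine hs.ae_eq ?_
  filter_upwards [hy] with x hx
  rw [hx, add_sub_cancel_right]

theorem memLp_component₂ (hm : Measurable κ) (hκ : MemLp κ 2 (P₀.prod Q₀ : Measure (Ω₁ × Ω₂)))
    (hadd : ∀ᵐ z ∂(P₀.prod Q₀ : Measure (Ω₁ × Ω₂)),
      κ z = component₁ κ Q₀ z.1 + component₂ κ P₀ z.2) :
    MemLp (component₂ κ P₀) 2 (Q₀ : Measure Ω₂) := by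
  rw [ProbabilityMeasure.toMeasure_prod] at *
  obtain ⟨x, hx, hx'⟩ :=
    ((Measure.ae_ae_of_ae_prod hadd).and hκ.integrable_sq.prod_right_ae).exists
  have hs : MemLp (fun y => κ (x, y) - component₁ κ Q₀ x) 2 (Q₀ : Measure Ω₂) := by
    refine MemLp.sub ?_ (memLp_const _)
    exact (memLp_two_iff_integrable_sq
      (hm.comp measurable_prodMk_left).aestronglyMeasurable).2 hx'
  refine hs.ae_eq ?_
  filter_upwards [hx] with y hy
  rw [hy, add_sub_cancel_left]

/-- The asymptotic variance vanishes only if both summands of the kernel do, that is, only for a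
null kernel. -/
theorem asymptoticVariance_pos {d : ℝ} (hd₀ : 0 < d) (hd₁ : d < 1)
    (h₁ : MemLp (component₁ κ Q₀) 2 (P₀ : Measure Ω₁))
    (h₂ : MemLp (component₂ κ P₀) 2 (Q₀ : Measure Ω₂))
    (hadd : ∀ᵐ z ∂(P₀.prod Q₀ : Measure (Ω₁ × Ω₂)),
      κ z = component₁ κ Q₀ z.1 + component₂ κ P₀ z.2)
    (hne : ∫ z, κ z ^ 2 ∂(P₀.prod Q₀ : Measure (Ω₁ × Ω₂)) ≠ 0) :
    0 < asymptoticVariance κ P₀ Q₀ d := by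
  have n1 : 0 ≤ ∫ x, component₁ κ Q₀ x ^ 2 ∂(P₀ : Measure Ω₁) :=
    integral_nonneg fun _ => sq_nonneg _
  have n2 : 0 ≤ ∫ y, component₂ κ P₀ y ^ 2 ∂(Q₀ : Measure Ω₂) :=
    integral_nonneg fun _ => sq_nonneg _
  have p1 : 0 < 1 / (1 - d) := one_div_pos.2 (by linarith)
  have p2 : 0 < 1 / d := one_div_pos.2 hd₀
  rw [asymptoticVariance]
  by_contra hcon
  have z1 : ∫ x, component₁ κ Q₀ x ^ 2 ∂(P₀ : Measure Ω₁) = 0 := by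
    by_contra h
    have := mul_pos p1 (n1.lt_of_ne' h)
    have := mul_nonneg p2.le n2
    linarith
  have z2 : ∫ y, component₂ κ P₀ y ^ 2 ∂(Q₀ : Measure Ω₂) = 0 := by
    by_contra h
    have := mul_pos p2 (n2.lt_of_ne' h)
    have := mul_nonneg p1.le n1
    linarith
  rw [integral_eq_zero_iff_of_nonneg (fun _ => sq_nonneg _) h₁.integrable_sq] at z1
  rw [integral_eq_zero_iff_of_nonneg (fun _ => sq_nonneg _) h₂.integrable_sq] at z2
  refine hne (integral_eq_zero_of_ae ?_)
  rw [ProbabilityMeasure.toMeasure_prod] at *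
  filter_upwards [hadd, Measure.quasiMeasurePreserving_fst.ae z1,
    Measure.quasiMeasurePreserving_snd.ae z2] with z hz h1 h2
  have h1' : component₁ κ Q₀ z.1 = 0 := by simpa using h1
  have h2' : component₂ κ P₀ z.2 = 0 := by simpa using h2
  simp [hz, h1', h2']

/-- If the kernel is additive on the sample, the test statistic is additive. -/
theorem testStatistic_eq_additiveStatistic {Ω₁ Ω₂ : Type*} {κ : Ω₁ × Ω₂ → ℝ} {f₁ : Ω₁ → ℝ} {f₂ : Ω₂ → ℝ} {n₁ n₂ : ℕ} (h₁ : 0 < n₁)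
    (h₂ : 0 < n₂) {ω : (Fin n₁ → Ω₁) × (Fin n₂ → Ω₂)}
    (h : ∀ i j, κ (ω.1 i, ω.2 j) = f₁ (ω.1 i) + f₂ (ω.2 j)) :
    testStatistic κ n₁ n₂ ω = additiveStatistic f₁ f₂ n₁ n₂
      (√((n₁ : ℝ) + (n₂ : ℝ)) / n₁) (√((n₁ : ℝ) + (n₂ : ℝ)) / n₂) ω := by
  have h₁' : (n₁ : ℝ) ≠ 0 := Nat.cast_ne_zero.2 h₁.ne'
  have h₂' : (n₂ : ℝ) ≠ 0 := Nat.cast_ne_zero.2 h₂.ne'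
  simp only [testStatistic, uStatistic, additiveStatistic, h, Finset.sum_add_distrib,
    Finset.sum_const, Finset.card_univ, Fintype.card_fin, nsmul_eq_mul, ← Finset.mul_sum]
  field_simp

theorem measurable_testStatistic (hm : Measurable κ) (n₁ n₂ : ℕ) :
    Measurable (testStatistic κ n₁ n₂) := by
  unfold testStatistic uStatistic
  fun_prop

theorem integral_oneSidedTest (hm : Measurable κ) (P₀ : ProbabilityMeasure Ω₁)
    (Q₀ : ProbabilityMeasure Ω₂) (d α : ℝ) (n₁ n₂ : ℕ)
    (ν : Measure ((Fin n₁ → Ω₁) × (Fin n₂ → Ω₂))) :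
    ∫ ω, oneSidedTest κ P₀ Q₀ d α n₁ n₂ ω ∂ν = ν.real {ω |
      stdNormalQuantile (1 - α) * √(asymptoticVariance κ P₀ Q₀ d) < testStatistic κ n₁ n₂ ω} := by
  rw [← integral_indicator_one (measurableSet_lt measurable_const
    (measurable_testStatistic hm n₁ n₂))]
  refine integral_congr_ae (ae_of_all _ fun ω => ?_)
  simp [oneSidedTest, Set.indicator_apply]

end Components

/-! ### The limit law of the additive statistic -/

section Limit

variable {Ω₁ Ω₂ : Type*} [MeasurableSpace Ω₁] [MeasurableSpace Ω₂]
  {ℱ : Set (ProbabilityMeasure (Ω₁ × Ω₂))}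
  {P : ℝ → ProbabilityMeasure Ω₁} {Q : ℝ → ProbabilityMeasure Ω₂} {g : Ω₁ × Ω₂ → ℝ}

/-- Tail probabilities of the additive statistic converge to those of its normal limit, whose
mean is the drift caused by the tangent. -/
theorem tendsto_measureReal_additiveStatistic
    (hc : IsL2Curve ℱ (fun t => (P t).prod (Q t)) g) {t : ℕ → ℝ} {τ : ℝ}
    (ht : Tendsto (fun n : ℕ => √(n : ℝ) * t n) atTop (𝓝 τ)) {f₁ : Ω₁ → ℝ} {f₂ : Ω₂ → ℝ}
    (hm₁ : Measurable f₁) (hm₂ : Measurable f₂) (hf₁ : MemLp f₁ 2 (P 0 : Measure Ω₁))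
    (hf₂ : MemLp f₂ 2 (Q 0 : Measure Ω₂)) (h₁ : ∫ x, f₁ x ∂(P 0 : Measure Ω₁) = 0)
    (h₂ : ∫ y, f₂ y ∂(Q 0 : Measure Ω₂) = 0) {n₁ n₂ : ℕ → ℕ} (hn : ∀ n, n₁ n + n₂ n = n)
    {d : ℝ} (hd₀ : 0 < d) (hd₁ : d < 1)
    (hd : Tendsto (fun n : ℕ => (n₂ n : ℝ) / (n : ℝ)) atTop (𝓝 d)) {v : ℝ}
    (hv : v = 1 / (1 - d) * ∫ x, f₁ x ^ 2 ∂(P 0 : Measure Ω₁)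
      + 1 / d * ∫ y, f₂ y ^ 2 ∂(Q 0 : Measure Ω₂)) (hvpos : 0 < v) (c : ℝ) :
    Tendsto (fun n => (sampleLaw (P (t n)) (Q (t n)) (n₁ n) (n₂ n)).real
      {ω | c < additiveStatistic f₁ f₂ (n₁ n) (n₂ n) (√(n : ℝ) / n₁ n) (√(n : ℝ) / n₂ n) ω}) atTop
      (𝓝 ((gaussianReal (τ * ∫ z, (f₁ z.1 + f₂ z.2) * g z
        ∂((P 0).prod (Q 0) : Measure (Ω₁ × Ω₂))) v.toNNReal).real (Set.Ioi c))) := by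
  have hd' : Tendsto (fun n : ℕ => (n₁ n : ℝ) / (n : ℝ)) atTop (𝓝 (1 - d)) := by
    refine (hd.const_sub 1).congr' ?_
    filter_upwards [eventually_gt_atTop 0] with n hn0
    have : (n : ℝ) ≠ 0 := Nat.cast_ne_zero.2 hn0.ne'
    have h : (n₁ n : ℝ) + n₂ n = n := by exact_mod_cast hn n
    rw [eq_div_iff this, sub_mul, div_mul_cancel₀ _ this]
    linarith
  -- the expansion of the characteristic function of one sample
  have hone : ∀ {m : ℕ → ℕ} {e : ℝ} (_ : 0 < e)
      (_ : Tendsto (fun n : ℕ => (m n : ℝ) / (n : ℝ)) atTop (𝓝 e)) {F : Ω₁ × Ω₂ → ℝ}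
      (_ : Measurable F) (_ : MemLp F 2 ((P 0).prod (Q 0) : Measure (Ω₁ × Ω₂)))
      (_ : ∫ z, F z ∂((P 0).prod (Q 0) : Measure (Ω₁ × Ω₂)) = 0) (s : ℝ),
      Tendsto (fun n => charFun (((P (t n)).prod (Q (t n)) : Measure (Ω₁ × Ω₂)).map F)
        (s * (√(n : ℝ) / m n)) ^ m n) atTop
        (𝓝 (Complex.exp (s * τ * (∫ z, F z * g z ∂((P 0).prod (Q 0) : Measure (Ω₁ × Ω₂)) : ℝ)
          * Complex.I - (s ^ 2 / 2 * (1 / e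
            * ∫ z, F z ^ 2 ∂((P 0).prod (Q 0) : Measure (Ω₁ × Ω₂))) : ℝ)))) := by
    intro m e he hme F hFm hF hF0 s
    have hmtop : Tendsto m atTop atTop := by
      have h := Tendsto.pos_mul_atTop he hme (tendsto_natCast_atTop_atTop (R := ℝ))
      refine tendsto_natCast_atTop_iff.1 (h.congr' ?_)
      filter_upwards [eventually_gt_atTop 0] with n hn0
      exact div_mul_cancel₀ _ (Nat.cast_ne_zero.2 hn0.ne')
    have hcs : Tendsto (fun n : ℕ => √(n : ℝ) * (s * (√(n : ℝ) / m n))) atTop (𝓝 (s / e)) := by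
      refine (tendsto_const_nhds.div hme he.ne').congr fun n => ?_
      have h := Real.mul_self_sqrt (Nat.cast_nonneg (α := ℝ) n)
      rw [Pi.div_apply, div_div_eq_mul_div]
      linear_combination -(s * (m n : ℝ)⁻¹) * h
    have hexp := hc.tendsto_mul_charFun_sub_one ht hFm hF hF0 hcs
    have hme' : Tendsto (fun n : ℕ => (((m n : ℝ) / (n : ℝ) : ℝ) : ℂ)) atTop (𝓝 (e : ℂ)) :=
      (Complex.continuous_ofReal.tendsto e).comp hme
    have hprod := hme'.mul hexp
    have hval : (e : ℂ) * (((s / e : ℝ) : ℂ) * τ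
          * (∫ z, F z * g z ∂((P 0).prod (Q 0) : Measure (Ω₁ × Ω₂)) : ℝ) * Complex.I
          - ((s / e) ^ 2 / 2 * ∫ z, F z ^ 2 ∂((P 0).prod (Q 0) : Measure (Ω₁ × Ω₂)) : ℝ))
        = s * τ * (∫ z, F z * g z ∂((P 0).prod (Q 0) : Measure (Ω₁ × Ω₂)) : ℝ)
          * Complex.I - (s ^ 2 / 2 * (1 / e
            * ∫ z, F z ^ 2 ∂((P 0).prod (Q 0) : Measure (Ω₁ × Ω₂))) : ℝ) := by
      have : (e : ℂ) ≠ 0 := Complex.ofReal_ne_zero.2 he.ne'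
      push_cast
      field_simp
    rw [hval] at hprod
    have hz := hprod.congr' (f₂ := fun n => (m n : ℂ) *
        (charFun (((P (t n)).prod (Q (t n)) : Measure (Ω₁ × Ω₂)).map F)
          (s * (√(n : ℝ) / m n)) - 1)) (by
      filter_upwards [eventually_gt_atTop 0] with n hn0
      have : (n : ℂ) ≠ 0 := Nat.cast_ne_zero.2 hn0.ne'
      push_cast
      field_simp)
    simpa using tendsto_one_add_pow_exp hmtop hz
  have hfst : ∀ u, (P u : Measure Ω₁).map f₁
      = ((P u).prod (Q u) : Measure (Ω₁ × Ω₂)).map (fun z => f₁ z.1) := fun u => by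
    have h := Measure.map_map (μ := (P u : Measure Ω₁).prod (Q u : Measure Ω₂)) hm₁ measurable_fst
    rw [Measure.map_fst_prod, measure_univ, one_smul] at h
    exact h
  have hsnd : ∀ u, (Q u : Measure Ω₂).map f₂
      = ((P u).prod (Q u) : Measure (Ω₁ × Ω₂)).map (fun z => f₂ z.2) := fun u => by
    have h := Measure.map_map (μ := (P u : Measure Ω₁).prod (Q u : Measure Ω₂)) hm₂ measurable_snd
    rw [Measure.map_snd_prod, measure_univ, one_smul] at h
    exact h
  have hi₁ : ∀ {φ : Ω₁ → ℝ}, ∫ z, φ z.1 ∂((P 0).prod (Q 0) : Measure (Ω₁ × Ω₂))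
      = ∫ x, φ x ∂(P 0 : Measure Ω₁) := fun {φ} => by
    rw [ProbabilityMeasure.toMeasure_prod, integral_fun_fst]
    simp
  have hi₂ : ∀ {φ : Ω₂ → ℝ}, ∫ z, φ z.2 ∂((P 0).prod (Q 0) : Measure (Ω₁ × Ω₂))
      = ∫ y, φ y ∂(Q 0 : Measure Ω₂) := fun {φ} => by
    rw [ProbabilityMeasure.toMeasure_prod, integral_fun_snd]
    simp
  have hF₁ : MemLp (fun z : Ω₁ × Ω₂ => f₁ z.1) 2 ((P 0).prod (Q 0) : Measure (Ω₁ × Ω₂)) :=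
    hf₁.comp_fst _
  have hF₂ : MemLp (fun z : Ω₁ × Ω₂ => f₂ z.2) 2 ((P 0).prod (Q 0) : Measure (Ω₁ × Ω₂)) :=
    hf₂.comp_snd _
  set b : ℝ := ∫ z, (f₁ z.1 + f₂ z.2) * g z ∂((P 0).prod (Q 0) : Measure (Ω₁ × Ω₂)) with hb
  have hbsum : b = ∫ z, f₁ z.1 * g z ∂((P 0).prod (Q 0) : Measure (Ω₁ × Ω₂))
      + ∫ z, f₂ z.2 * g z ∂((P 0).prod (Q 0) : Measure (Ω₁ × Ω₂)) := by
    simp only [hb, add_mul]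
    exact integral_add (hF₁.integrable_mul hc.memLp) (hF₂.integrable_mul hc.memLp)
  have hmeas := fun n => measurable_additiveStatistic hm₁ hm₂ (n₁ n) (n₂ n) (√(n : ℝ) / n₁ n)
    (√(n : ℝ) / n₂ n)
  let μ : ℕ → ProbabilityMeasure ℝ := fun n =>
    ⟨(sampleLaw (P (t n)) (Q (t n)) (n₁ n) (n₂ n)).map
      (additiveStatistic f₁ f₂ (n₁ n) (n₂ n) (√(n : ℝ) / n₁ n) (√(n : ℝ) / n₂ n)),
      Measure.isProbabilityMeasure_map (hmeas n).aemeasurable⟩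
  let μ₀ : ProbabilityMeasure ℝ := ⟨gaussianReal (τ * b) v.toNNReal, inferInstance⟩
  have hweak : Tendsto μ atTop (𝓝 μ₀) := by
    refine ProbabilityMeasure.tendsto_iff_tendsto_charFun.2 fun s => ?_
    have l₁ := hone (sub_pos.2 hd₁) hd' (hm₁.comp measurable_fst) hF₁ (hi₁.trans h₁) s
    have l₂ := hone hd₀ hd (hm₂.comp measurable_snd) hF₂ (hi₂.trans h₂) s
    have l := l₁.mul l₂
    rw [← Complex.exp_add] at l
    convert l using 1
    · funext n
      simp only [μ, ProbabilityMeasure.coe_mk, charFun_additiveStatistic hm₁ hm₂, hfst, hsnd,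
        Function.comp_def]
    · congr 1
      simp only [μ₀, ProbabilityMeasure.coe_mk, charFun_gaussianReal, Function.comp_def,
        hi₁ (φ := fun x => f₁ x ^ 2), hi₂ (φ := fun y => f₂ y ^ 2),
        Real.coe_toNNReal _ hvpos.le]
      congr 1
      rw [hv, hbsum]
      push_cast
      ring
  have hfr : (μ₀ : Measure ℝ) (frontier (Set.Ioi c)) = 0 := by
    have : NullSingletonClass (gaussianReal (τ * b) v.toNNReal) :=
      nullSingletonClass_gaussianReal (by simpa using hvpos)
    rw [frontier_Ioi]
    exact measure_singleton (μ := gaussianReal (τ * b) v.toNNReal) c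
  have hlim := (ENNReal.tendsto_toReal (measure_ne_top _ _)).comp
    (ProbabilityMeasure.tendsto_measure_of_null_frontier_of_tendsto' hweak hfr)
  refine hlim.congr fun n => ?_
  simp only [Function.comp_apply, μ, ProbabilityMeasure.coe_mk]
  rw [Measure.map_apply (hmeas n) measurableSet_Ioi]
  rfl

end Limit

/-! ### The asymptotic power of the test -/

section Power

variable {Ω₁ Ω₂ : Type*} [MeasurableSpace Ω₁] [MeasurableSpace Ω₂]
  {ℱ₁ : Set (ProbabilityMeasure Ω₁)} {ℱ₂ : Set (ProbabilityMeasure Ω₂)}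
  {k : ProbabilityMeasure (Ω₁ × Ω₂) → ℝ}
  {P : ℝ → ProbabilityMeasure Ω₁} {Q : ℝ → ProbabilityMeasure Ω₂} {g κ : Ω₁ × Ω₂ → ℝ}

/-- A canonical gradient on a product family is the sum of its two conditional expectations. -/
theorem IsCanonicalGradient.ae_eq_add_component {P₀ : ProbabilityMeasure Ω₁}
    {Q₀ : ProbabilityMeasure Ω₂}
    (hκ : IsCanonicalGradient (productFamily ℱ₁ ℱ₂) k (P₀.prod Q₀) κ) :
    ∀ᵐ z ∂(P₀.prod Q₀ : Measure (Ω₁ × Ω₂)),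
      κ z = component₁ κ Q₀ z.1 + component₂ κ P₀ z.2 := by
  refine TwoSample.ae_eq_add_component (hκ.isGradient.memLp.integrable one_le_two)
    fun A B hA hB => ?_
  have h := setIntegral_prod_eq_of_mem_tangentSpace hκ.mem_tangentSpace hA hB
  have hint : ∀ s : Set (Ω₁ × Ω₂),
      ∫ z in s, hκ.isGradient.memLp.toLp κ z ∂(P₀.prod Q₀ : Measure (Ω₁ × Ω₂))
        = ∫ z in s, κ z ∂(P₀.prod Q₀ : Measure (Ω₁ × Ω₂)) := fun s =>
    integral_congr_ae (ae_restrict_of_ae hκ.isGradient.memLp.coeFn_toLp)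
  simpa only [hint] using h

/-- The asymptotic power of the test along parameters `t n ~ τ / √n`. -/
theorem tendsto_integral_oneSidedTest
    (hcurve : IsL2Curve (productFamily ℱ₁ ℱ₂) (fun t => (P t).prod (Q t)) g)
    (hκ_meas : Measurable κ)
    (hκ : IsCanonicalGradient (productFamily ℱ₁ ℱ₂) k ((P 0).prod (Q 0)) κ)
    (hκ_ne : ∫ z, κ z ^ 2 ∂((P 0).prod (Q 0) : Measure (Ω₁ × Ω₂)) ≠ 0)
    {n₁ n₂ : ℕ → ℕ} (hn : ∀ n, n₁ n + n₂ n = n) {d : ℝ} (hd₀ : 0 < d) (hd₁ : d < 1)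
    (hd : Tendsto (fun n : ℕ => (n₂ n : ℝ) / (n : ℝ)) atTop (𝓝 d)) (α : ℝ)
    {t : ℕ → ℝ} {τ : ℝ} (ht : Tendsto (fun n : ℕ => √(n : ℝ) * t n) atTop (𝓝 τ)) :
    Tendsto (fun n : ℕ => ∫ ω, oneSidedTest κ (P 0) (Q 0) d α (n₁ n) (n₂ n) ω
        ∂(sampleLaw (P (t n)) (Q (t n)) (n₁ n) (n₂ n))) atTop
      (𝓝 (stdNormalCDF (τ * (∫ z, κ z * g z ∂((P 0).prod (Q 0) : Measure (Ω₁ × Ω₂)))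
        * (√(asymptoticVariance κ (P 0) (Q 0) d))⁻¹ - stdNormalQuantile (1 - α)))) := by
  have hL2 := hκ.isGradient.memLp
  have hint := hL2.integrable one_le_two
  have hadd := hκ.ae_eq_add_component
  have m₁ := measurable_component₁ hκ_meas (Q 0)
  have m₂ := measurable_component₂ hκ_meas (P 0)
  have l₁ := memLp_component₁ hκ_meas hL2 hadd
  have l₂ := memLp_component₂ hκ_meas hL2 hadd
  have z₁ := (integral_component₁ hint).trans hκ.isGradient.integral_eq_zero
  have z₂ := (integral_component₂ hint).trans hκ.isGradient.integral_eq_zero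
  have hv := asymptoticVariance_pos hd₀ hd₁ l₁ l₂ hadd hκ_ne
  set c : ℝ := stdNormalQuantile (1 - α) * √(asymptoticVariance κ (P 0) (Q 0) d) with hc
  have hlim := tendsto_measureReal_additiveStatistic hcurve ht m₁ m₂ l₁ l₂ z₁ z₂ hn hd₀ hd₁ hd
    rfl hv c
  have hdrift : ∫ z, (component₁ κ (Q 0) z.1 + component₂ κ (P 0) z.2) * g z
      ∂((P 0).prod (Q 0) : Measure (Ω₁ × Ω₂))
      = ∫ z, κ z * g z ∂((P 0).prod (Q 0) : Measure (Ω₁ × Ω₂)) := by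
    refine integral_congr_ae ?_
    filter_upwards [hadd] with z hz
    rw [hz]
  rw [hdrift] at hlim
  change Tendsto _ _ (𝓝 ((gaussianReal _
    (asymptoticVariance κ (P 0) (Q 0) d).toNNReal).real (Set.Ioi c))) at hlim
  rw [hc, gaussianReal_real_Ioi _ hv] at hlim
  -- both sample sizes are eventually positive
  have hpos₂ : ∀ᶠ n in atTop, 0 < n₂ n := by
    filter_upwards [hd.eventually_const_lt hd₀] with n h
    rcases Nat.eq_zero_or_pos (n₂ n) with h0 | h0
    · simp [h0] at h
    · exact h0
  have hpos₁ : ∀ᶠ n in atTop, 0 < n₁ n := by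
    filter_upwards [hd.eventually_lt_const hd₁, eventually_gt_atTop 0] with n h hn0
    rcases Nat.eq_zero_or_pos (n₁ n) with h0 | h0
    · have h2 : n₂ n = n := by have := hn n; omega
      rw [h2, div_self (Nat.cast_ne_zero.2 hn0.ne')] at h
      exact absurd h (lt_irrefl 1)
    · exact h0
  -- the test statistic differs from its additive form with vanishing probability only
  have hsing := hcurve.tendsto_mul_singular (tendsto_of_tendsto_sqrt_mul ht) ht
  refine hlim.congr_dist (squeeze_zero' (Eventually.of_forall fun _ => dist_nonneg) ?_ hsing)
  filter_upwards [hpos₁, hpos₂] with n h₁ h₂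
  set ν := sampleLaw (P (t n)) (Q (t n)) (n₁ n) (n₂ n) with hν
  rw [integral_oneSidedTest hκ_meas, dist_comm, Real.dist_eq, Real.sq_sqrt (Nat.cast_nonneg n)]
  have hset : MeasurableSet {z : Ω₁ × Ω₂ |
      κ z = component₁ κ (Q 0) z.1 + component₂ κ (P 0) z.2} :=
    measurableSet_eq_fun hκ_meas ((m₁.comp measurable_fst).add (m₂.comp measurable_snd))
  have hbad := sampleLaw_exists_not_le (P := P (t n)) (Q := Q (t n)) hset hadd (n₁ n) (n₂ n)
  set bad := {ω : (Fin (n₁ n) → Ω₁) × (Fin (n₂ n) → Ω₂) | ∃ i j, ¬ (κ (ω.1 i, ω.2 j)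
    = component₁ κ (Q 0) (ω.1 i) + component₂ κ (P 0) (ω.2 j))} with hbad_def
  have hgood : ∀ ω ∉ bad, testStatistic κ (n₁ n) (n₂ n) ω
      = additiveStatistic (component₁ κ (Q 0)) (component₂ κ (P 0)) (n₁ n) (n₂ n)
        (√(n : ℝ) / n₁ n) (√(n : ℝ) / n₂ n) ω := by
    intro ω hω
    have hnn : (n₁ n : ℝ) + (n₂ n : ℝ) = n := by exact_mod_cast hn n
    have h : ∀ i j, κ (ω.1 i, ω.2 j)
        = component₁ κ (Q 0) (ω.1 i) + component₂ κ (P 0) (ω.2 j) := by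
      simpa [hbad_def] using hω
    rw [testStatistic_eq_additiveStatistic h₁ h₂ h, hnn]
  have hbad_real : ν.real bad ≤ n * ((P (t n)).prod (Q (t n)) : Measure (Ω₁ × Ω₂)).real
      {z | densityQuotient ((P (t n)).prod (Q (t n)) : Measure (Ω₁ × Ω₂))
        ((P 0).prod (Q 0) : Measure (Ω₁ × Ω₂)) z = ∞} := by
    have hcast : (n₁ n : ℝ≥0∞) + (n₂ n : ℝ≥0∞) = n := by exact_mod_cast hn n
    rw [hcast] at hbad
    have := ENNReal.toReal_mono
      (ENNReal.mul_ne_top (ENNReal.natCast_ne_top n) (measure_ne_top _ _)) hbad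
    rwa [ENNReal.toReal_mul, ENNReal.toReal_natCast] at this
  refine le_trans ?_ hbad_real
  rw [abs_sub_le_iff, sub_le_iff_le_add', sub_le_iff_le_add']
  constructor
  · refine (measureReal_mono fun ω hω => ?_).trans (measureReal_union_le _ _)
    by_cases hb : ω ∈ bad
    · exact Or.inr hb
    · exact Or.inl (by rwa [Set.mem_ofPred_eq, ← hgood ω hb])
  · refine (measureReal_mono fun ω hω => ?_).trans (measureReal_union_le _ _)
    by_cases hb : ω ∈ bad
    · exact Or.inr hb
    · exact Or.inl (by rwa [Set.mem_ofPred_eq, hgood ω hb])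

end Power

end TwoSample

theorem mainTheorem4 {Ω₁ Ω₂ : Type*} [MeasurableSpace Ω₁] [MeasurableSpace Ω₂]
    (ℱ₁ : Set (ProbabilityMeasure Ω₁)) (ℱ₂ : Set (ProbabilityMeasure Ω₂))
    (k : ProbabilityMeasure (Ω₁ × Ω₂) → ℝ)
    (P : ℝ → ProbabilityMeasure Ω₁) (Q : ℝ → ProbabilityMeasure Ω₂)
    (g κ : Ω₁ × Ω₂ → ℝ)
    (hcurve : TwoSample.IsL2Curve (TwoSample.productFamily ℱ₁ ℱ₂)
      (fun t => (P t).prod (Q t)) g)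
    (hκ_meas : Measurable κ)
    (hκ : TwoSample.IsCanonicalGradient (TwoSample.productFamily ℱ₁ ℱ₂) k
      ((P 0).prod (Q 0)) κ)
    (hκ_ne : ∫ z, κ z ^ 2 ∂((P 0).prod (Q 0) : Measure (Ω₁ × Ω₂)) ≠ 0)
    (hκg_ne : ∫ z, κ z * g z ∂((P 0).prod (Q 0) : Measure (Ω₁ × Ω₂)) ≠ 0)
    (n₁ n₂ : ℕ → ℕ) (hn : ∀ n, n₁ n + n₂ n = n)
    (d : ℝ) (hd₀ : 0 < d) (hd₁ : d < 1)
    (hd : Tendsto (fun n : ℕ => (n₂ n : ℝ) / (n : ℝ)) atTop (𝓝 d))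
    (α : ℝ) (hα₀ : 0 < α) (hα₁ : α < 1)
    (ϑ : ℝ) (hϑ : ϑ ≠ 0)
    (t : ℕ → ℝ) (ht : Tendsto t atTop (𝓝 0))
    (hk : (fun n : ℕ => k ((P (t n)).prod (Q (t n)))
        - (k ((P 0).prod (Q 0)) + (n : ℝ) ^ (-(1 / 2) : ℝ) * ϑ))
      =o[atTop] (fun n : ℕ => (n : ℝ) ^ (-(1 / 2) : ℝ))) :
    TwoSample.AsymptoticallySimilar
      (fun n => TwoSample.sampleLaw (P 0) (Q 0) (n₁ n) (n₂ n))
      (fun n => TwoSample.oneSidedTest κ (P 0) (Q 0) d α (n₁ n) (n₂ n)) α ∧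
    Tendsto
      (fun n : ℕ => ∫ ω, TwoSample.oneSidedTest κ (P 0) (Q 0) d α (n₁ n) (n₂ n) ω
        ∂(TwoSample.sampleLaw (P (t n)) (Q (t n)) (n₁ n) (n₂ n)))
      atTop
      (𝓝 (TwoSample.stdNormalCDF
        (ϑ * TwoSample.asymptoticVariance κ (P 0) (Q 0) d ^ (-(1 / 2) : ℝ)
          - TwoSample.stdNormalQuantile (1 - α)))) ∧
    (ϑ < 0 →
      limsup (fun n : ℕ => ∫ ω, TwoSample.oneSidedTest κ (P 0) (Q 0) d α (n₁ n) (n₂ n) ω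
        ∂(TwoSample.sampleLaw (P (t n)) (Q (t n)) (n₁ n) (n₂ n))) atTop ≤ α) := by
  set u := TwoSample.stdNormalQuantile (1 - α) with hu
  set v := TwoSample.asymptoticVariance κ (P 0) (Q 0) d with hv
  have hα : TwoSample.stdNormalCDF (-u) = α := by
    rw [TwoSample.stdNormalCDF_neg, hu,
      TwoSample.stdNormalCDF_stdNormalQuantile (by linarith) (by linarith)]
    ring
  have hv0 : 0 ≤ v := by
    rw [hv, TwoSample.asymptoticVariance]
    have h1 : 0 < 1 - d := by linarith
    positivity
  have hpow : v ^ (-(1 / 2) : ℝ) = (√v)⁻¹ := by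
    rw [Real.rpow_neg hv0, Real.sqrt_eq_rpow]
  have hlevel := TwoSample.tendsto_integral_oneSidedTest hcurve hκ_meas hκ hκ_ne hn hd₀ hd₁ hd α
    (t := fun _ => 0) (τ := 0) (by simp)
  rw [zero_mul, zero_mul, zero_sub, ← hu, hα] at hlevel
  have hrate := TwoSample.IsGradient.tendsto_sqrt_mul (p := fun t => (P t).prod (Q t))
    hκ.isGradient hcurve hκg_ne hϑ ht hk
  have hpower := TwoSample.tendsto_integral_oneSidedTest hcurve hκ_meas hκ hκ_ne hn hd₀ hd₁ hd α
    hrate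
  rw [div_mul_cancel₀ _ hκg_ne, ← hu, ← hv, ← hpow] at hpower
  refine ⟨hlevel, hpower, fun hneg => ?_⟩
  rw [hpower.limsup_eq, ← hα]
  refine monotone_cdf _ ?_
  have : ϑ * v ^ (-(1 / 2) : ℝ) ≤ 0 :=
    mul_nonpos_of_nonpos_of_nonneg hneg.le (Real.rpow_nonneg hv0 _)
  linarith
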